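/- For $\alpha>1$ let $\mathcal{M}_\alpha$ be the class of functions $f:[0,\infty)\to\mathbb{C}$ with $f\in C^{2}[0,\infty)$ (one-sided derivatives at $0$) and $f^{(j)}(x)=O(x^{-\alpha-j})$ as $x\to\infty$ for $j=0,1,2$. Let $(F_cf)(x)=\sqrt{2/\pi}\int_0^\infty f(t)\cos(xt)\,dt$ be the Fourier cosine transform, $d(n)$ the number of positive divisors of $n$, $\gamma$ the Euler constant, and $K_0$, $Y_0$ the modified Bessel function and the Bessel function of the second kind of order zero. Theorem 3. Let $\alpha>2$, let $f\in\mathcal{M}_\alpha$, and suppose that the function $x\mapsto x^{-1}(F_cf)(x^{-1})$, $x>0$, belongs to $\mathcal{M}_\alpha$ as well (that is, it extends to $[0,\infty)$ as a member of $\mathcal{M}_\alpha$). Put $$G(x)=\int_0^\infty\left[4K_0\left(4\pi\sqrt{xy}\right)-2\pi Y_0\left(4\pi\sqrt{xy}\right)\right]f(y)\,dy,\qquad x>0.$$ Then the Voronoi summation formula $$\sum_{n=1}^\infty d(n)f(nx)-\int_0^\infty f(xy)\,(\log y+2\gamma)\,dy=\frac{f(0)}{4}+\frac1x\sum_{n=1}^\infty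 d(n)\,G\left(\frac nx\right)$$ holds for all $x>0$, where all the series and integrals in it (including the one that defines $G$) converge absolutely. -/

import Mathlib

open MeasureTheory Set Filter Asymptotics

noncomputable section

/-- The Müntz type class `M_α`: functions that are twice continuously differentiable on `[0, ∞)`
(with one-sided derivatives at `0`) and satisfy `f^{(j)}(x) = O(x^{-α-j})` as `x → ∞` for
`j = 0, 1, 2`.  Only the values of `f` on `[0, ∞)` matter. -/
structure MuntzClass (α : ℝ) (f : ℝ → ℂ) : Prop where
  contDiffOn : ContDiffOn ℝ 2 f (Ici 0)
  isBigO : ∀ j : ℕ, j ≤ 2 →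
    (fun x : ℝ => iteratedDerivWithin j f (Ici 0) x) =O[atTop] fun x : ℝ => x ^ (-α - (j : ℝ))

/-- The Fourier cosine transform `(F_c f)(x) = √(2/π) ∫_0^∞ f(t) cos(xt) dt`. -/
def fourierCos (f : ℝ → ℂ) (x : ℝ) : ℂ :=
  (Real.sqrt (2 / Real.pi) : ℂ) * ∫ t in Ioi (0 : ℝ), f t * (Real.cos (x * t) : ℂ)

/-- The modified Bessel function `K_0` of the second kind on `(0, ∞)`:
`K_0(x) = ∫_0^∞ exp(-x cosh t) dt`. -/
def besselK0 (x : ℝ) : ℝ :=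
  ∫ t in Ioi (0 : ℝ), Real.exp (-(x * Real.cosh t))

/-- The Bessel function `Y_0` of the second kind on `(0, ∞)`, by Schläfli's integral (order zero):
`Y_0(x) = (1/π) ∫_0^π sin(x sin θ) dθ - (2/π) ∫_0^∞ exp(-x sinh t) dt`. -/
def besselY0 (x : ℝ) : ℝ :=
  1 / Real.pi * (∫ θ in (0 : ℝ)..Real.pi, Real.sin (x * Real.sin θ)) -
    2 / Real.pi * ∫ t in Ioi (0 : ℝ), Real.exp (-(x * Real.sinh t))

/-- The kernel `4 K_0(4π√z) - 2π Y_0(4π√z)`, for `z > 0`. -/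
def voronoiKernel (z : ℝ) : ℝ :=
  4 * besselK0 (4 * Real.pi * Real.sqrt z) -
    2 * Real.pi * besselY0 (4 * Real.pi * Real.sqrt z)

/-- The integral transform `G(x) = ∫_0^∞ [4 K_0(4π√(xy)) - 2π Y_0(4π√(xy))] f(y) dy`. -/
def voronoiTransform (f : ℝ → ℂ) (x : ℝ) : ℂ :=
  ∫ y in Ioi (0 : ℝ), (voronoiKernel (x * y) : ℂ) * f y

/-- The Voronoi operator
`(V f)(x) = ∑_{n ≥ 1} d(n) f(nx) - ∫_0^∞ f(xy) (log y + 2γ) dy`,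
where `d(n)` is the number of divisors of `n`.  The term `n = 0` of the series vanishes,
as `Nat.divisors 0 = ∅`. -/
def voronoiOperator (f : ℝ → ℂ) (x : ℝ) : ℂ :=
  (∑' n : ℕ, (n.divisors.card : ℂ) * f (n * x)) -
    ∫ y in Ioi (0 : ℝ), f (x * y) * ((Real.log y + 2 * Real.eulerMascheroniConstant : ℝ) : ℂ)

end

/-! Voronoi's formula is Poisson's formula applied twice. Write `f̂` for `cosTransform f` and `H(v)
= v⁻¹ f̂(v⁻¹)`; up to scaling, `H` is the second function of the hypothesis, so it is smooth and
decays too. The relation between `f` and `H` is used at both ends. Decay of `f̂` at infinity gives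
`H(v) = O(v)`, hence `H(0) = 0`. Decay of `H` at infinity gives `f̂(0) = 0`, that is `∫ f = 0`, so
the term with `2γ` disappears.

Poisson's formula for `f(t·)` now reads `F(t) := ∑ f(kt) = -f(0)/2 + ∑ k⁻¹ H(t/k)`. Comparing the
sum of `F` over `m ≥ 1` with its integral, and applying Poisson again to each `k⁻¹ H(·/k)`, gives `∑
F(m) - ∫ F = f(0)/4 + ∑∑ Ĥ(km)` (`CosPair.tsum_dilationSum`). The limits may be exchanged because
the trapezoidal error of `k⁻¹ H(·/k)` is at most `k⁻² ∫ |H''|`, uniformly in the length of the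
interval.

Three identifications remain. The double sums are divisor sums (`divisor_sum_eq_double_sum`). The
integral `∫ F` equals `∫ f(t) log t dt`, since the Mellin transform of `F` is `ζ` times that of `f`,
and the pole of `ζ` at `1` meets a zero (`CosPair.integral_dilationSum`). Finally `G = Ĥ`
(`CosPair.voronoiTransform_eq`), because the kernel is the conditionally convergent integral of `4
cos(2πξeˢ) cos(2πe⁻ˢy)` over real `s`, which a contour shift evaluates by `K₀` and `Y₀`. -/

/-- `f` is `C²` on `[0, ∞)` with derivatives `f₁`, `f₂`, all three being `O((1 + t)^{-α})`. -/
structure SmoothDecay (α : ℝ) (f f₁ f₂ : ℝ → ℂ) : Prop where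
  deriv₁ : ∀ t ∈ Ici (0 : ℝ), HasDerivWithinAt f (f₁ t) (Ici 0) t
  deriv₂ : ∀ t ∈ Ici (0 : ℝ), HasDerivWithinAt f₁ (f₂ t) (Ici 0) t
  cont₂ : ContinuousOn f₂ (Ici 0)
  decay : ∃ C, ∀ t ∈ Ici (0 : ℝ), ‖f t‖ ≤ C * (1 + t) ^ (-α) ∧ ‖f₁ t‖ ≤ C * (1 + t) ^ (-α) ∧
    ‖f₂ t‖ ≤ C * (1 + t) ^ (-α)

/-- The cosine transform `u ↦ 2 ∫_0^∞ f(t) cos(2πut) dt`, i.e. the Fourier transform of the even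
extension of `f`. -/
noncomputable def cosTransform (f : ℝ → ℂ) (u : ℝ) : ℂ :=
  2 * ∫ t in Ioi (0 : ℝ), f t * (Real.cos (2 * Real.pi * u * t) : ℂ)

/-! ### Uniform bounds from the class `M_α`, and dilations -/

lemma exists_bound_of_isBigO_rpow {α β : ℝ} (hα : 0 ≤ α) (hαβ : α ≤ β) {f : ℝ → ℂ}
    (hf : ContinuousOn f (Ici 0)) (hO : f =O[atTop] fun x : ℝ => x ^ (-β)) :
    ∃ C, ∀ t ∈ Ici (0 : ℝ), ‖f t‖ ≤ C * (1 + t) ^ (-α) := by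
  obtain ⟨c, hc⟩ := hO.bound
  obtain ⟨R, hR⟩ := eventually_atTop.1 hc
  set S := max R 1
  have hS : 1 ≤ S := le_max_right _ _
  obtain ⟨D, hD⟩ := isCompact_Icc.exists_bound_of_continuousOn
    (hf.mono (Icc_subset_Ici_self : Icc 0 S ⊆ Ici 0))
  -- The first constant serves the tail, where `t ≥ 1` gives `t ≥ (1 + t)/2`; the second serves the
  -- compact part `[0, S]`.
  refine ⟨max (|c| * 2 ^ α) (|D| * (1 + S) ^ α), fun t (ht : 0 ≤ t) => ?_⟩
  have h1 : (0 : ℝ) < 1 + t := by linarith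
  rcases le_total t S with h | h
  · calc ‖f t‖ ≤ |D| := (hD t ⟨ht, h⟩).trans (le_abs_self D)
      _ = |D| * (1 + S) ^ α * (1 + S) ^ (-α) := by
          rw [mul_assoc, ← Real.rpow_add (by linarith)]; simp
      _ ≤ |D| * (1 + S) ^ α * (1 + t) ^ (-α) := by
          refine mul_le_mul_of_nonneg_left ?_ (by positivity)
          exact Real.rpow_le_rpow_of_nonpos h1 (by linarith) (by linarith)
      _ ≤ _ := by gcongr; exact le_max_right _ _
  · have ht1 : 1 ≤ t := hS.trans h
    calc ‖f t‖ ≤ c * ‖t ^ (-β)‖ := hR t ((le_max_left _ _).trans h)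
      _ ≤ |c| * t ^ (-β) := by
          rw [Real.norm_of_nonneg (by positivity)]
          exact mul_le_mul_of_nonneg_right (le_abs_self c) (by positivity)
      _ ≤ |c| * t ^ (-α) := by
          gcongr
      _ ≤ |c| * ((1 + t) / 2) ^ (-α) := by
          refine mul_le_mul_of_nonneg_left ?_ (abs_nonneg c)
          exact Real.rpow_le_rpow_of_nonpos (by linarith) (by linarith) (by linarith)
      _ = |c| * 2 ^ α * (1 + t) ^ (-α) := by
          rw [Real.div_rpow h1.le (by norm_num), Real.rpow_neg (by norm_num : (0 : ℝ) ≤ 2)]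
          field_simp
      _ ≤ _ := by gcongr; exact le_max_left _ _

lemma MuntzClass.smoothDecay {α : ℝ} (hα : 0 ≤ α) {f : ℝ → ℂ} (hf : MuntzClass α f) :
    ∃ f₁ f₂, SmoothDecay α f f₁ f₂ := by
  have hu : UniqueDiffOn ℝ (Ici (0 : ℝ)) := uniqueDiffOn_Ici 0
  have hc := hf.contDiffOn
  have e1 : ∀ x, iteratedDerivWithin 1 f (Ici 0) x = derivWithin f (Ici 0) x := fun x => by
    rw [iteratedDerivWithin_one]
  have e2 : iteratedDerivWithin 2 f (Ici 0) = derivWithin (derivWithin f (Ici 0)) (Ici 0) := by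
    ext x
    rw [show (2 : ℕ) = 1 + 1 from rfl, iteratedDerivWithin_succ]
    congr 1
    ext y; exact e1 y
  have hd1 : ContDiffOn ℝ 1 (derivWithin f (Ici 0)) (Ici 0) :=
    hc.derivWithin hu (by norm_num)
  have hd2 : ContinuousOn (derivWithin (derivWithin f (Ici 0)) (Ici 0)) (Ici 0) :=
    hd1.continuousOn_derivWithin hu le_rfl
  have b0 := hf.isBigO 0 (by norm_num)
  have b1 := hf.isBigO 1 (by norm_num)
  have b2 := hf.isBigO 2 (by norm_num)
  simp only [e1, e2, iteratedDerivWithin_zero] at b0 b1 b2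
  obtain ⟨C0, h0⟩ := exists_bound_of_isBigO_rpow (α := α) (β := α + (0 : ℕ)) hα (by simp)
    hc.continuousOn (by convert b0 using 3; ring)
  obtain ⟨C1, h1⟩ := exists_bound_of_isBigO_rpow (α := α) (β := α + (1 : ℕ)) hα (by simp)
    hd1.continuousOn (by convert b1 using 3; ring)
  obtain ⟨C2, h2⟩ := exists_bound_of_isBigO_rpow (α := α) (β := α + (2 : ℕ)) hα (by simp)
    hd2 (by convert b2 using 3; ring)
  refine ⟨_, _, ⟨fun t ht => ((hc.differentiableOn (by norm_num)) t ht).hasDerivWithinAt,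
    fun t ht => ((hd1.differentiableOn (by norm_num)) t ht).hasDerivWithinAt, hd2,
    max C0 (max C1 C2), fun t ht => ⟨(h0 t ht).trans ?_, (h1 t ht).trans ?_, (h2 t ht).trans ?_⟩⟩⟩
  all_goals
    have : (0 : ℝ) < 1 + t := by linarith [mem_Ici.1 ht]
    gcongr
    simp

namespace SmoothDecay

variable {α : ℝ} {f f₁ f₂ : ℝ → ℂ}

lemma comp_mul (hf : SmoothDecay α f f₁ f₂) (hα : 0 ≤ α) (c : ℂ) {a : ℝ} (ha : 0 < a) :
    SmoothDecay α (fun t => c * f (a * t)) (fun t => c * (a * f₁ (a * t)))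
      (fun t => c * (a * (a * f₂ (a * t)))) := by
  have hm : MapsTo (fun t : ℝ => a * t) (Ici 0) (Ici 0) := fun t (ht : 0 ≤ t) =>
    mem_Ici.2 (by positivity)
  have key : ∀ g g' : ℝ → ℂ, (∀ t ∈ Ici (0 : ℝ), HasDerivWithinAt g (g' t) (Ici 0) t) →
      ∀ t ∈ Ici (0 : ℝ), HasDerivWithinAt (fun t => g (a * t)) (a * g' (a * t)) (Ici 0) t := by
    intro g g' hg t ht
    have := (hg (a * t) (hm ht)).scomp t (((hasDerivAt_id t).const_mul a).hasDerivWithinAt) hm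
    simpa [Function.comp_def] using this
  obtain ⟨C, hC⟩ := hf.decay
  refine ⟨fun t ht => (key f f₁ hf.deriv₁ t ht).const_mul c,
    fun t ht => ((key f₁ f₂ hf.deriv₂ t ht).const_mul (a : ℂ)).const_mul c, ?_, ?_⟩
  · exact continuousOn_const.mul (continuousOn_const.mul (continuousOn_const.mul
      (hf.cont₂.comp (by fun_prop) hm)))
  · have hC0 : 0 ≤ C := by
      have := (norm_nonneg _).trans (hC 0 self_mem_Ici).1
      simpa using this
    -- This choice gives `1 + a t ≥ m (1 + t)`, which transfers the decay to the dilate.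
    set m := min 1 a
    have hm0 : 0 < m := lt_min one_pos ha
    refine ⟨‖c‖ * (1 + a + a * a) * (C * m ^ (-α)), fun t ht => ?_⟩
    have ht : 0 ≤ t := ht
    have hle : (1 + a * t) ^ (-α) ≤ m ^ (-α) * (1 + t) ^ (-α) := by
      rw [← Real.mul_rpow hm0.le (by linarith)]
      refine Real.rpow_le_rpow_of_nonpos (by positivity) ?_ (by linarith)
      rw [mul_add]
      have h1 : m ≤ 1 := min_le_left _ _
      have h2 : m ≤ a := min_le_right _ _
      nlinarith
    have hp : 0 ≤ (1 + t) ^ (-α) := by positivity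
    have hq : 0 ≤ m ^ (-α) := by positivity
    obtain ⟨h0, h1, h2⟩ := hC (a * t) (hm ht)
    have hb : ∀ z : ℂ, ∀ w : ℝ, 0 ≤ w → w ≤ 1 + a + a * a → ‖z‖ ≤ C * (1 + a * t) ^ (-α) →
        ‖c‖ * (w * ‖z‖) ≤ ‖c‖ * (1 + a + a * a) * (C * m ^ (-α)) * (1 + t) ^ (-α) := by
      intro z w hw hw' hz
      calc ‖c‖ * (w * ‖z‖) ≤ ‖c‖ * ((1 + a + a * a) * (C * (m ^ (-α) * (1 + t) ^ (-α)))) := by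
            gcongr; exact hz.trans (by gcongr)
        _ = _ := by ring
    refine ⟨?_, ?_, ?_⟩
    · rw [norm_mul]
      simpa using hb _ 1 zero_le_one (by nlinarith) h0
    · rw [norm_mul, norm_mul, Complex.norm_real, Real.norm_of_nonneg ha.le]
      exact hb _ a ha.le (by nlinarith) h1
    · rw [norm_mul, norm_mul, norm_mul, Complex.norm_real, Real.norm_of_nonneg ha.le, ← mul_assoc a]
      exact hb _ (a * a) (by positivity) (by nlinarith) h2

lemma continuousOn (hf : SmoothDecay α f f₁ f₂) : ContinuousOn f (Ici 0) :=
  fun t ht => (hf.deriv₁ t ht).continuousWithinAt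

lemma continuousOn₁ (hf : SmoothDecay α f f₁ f₂) : ContinuousOn f₁ (Ici 0) :=
  fun t ht => (hf.deriv₂ t ht).continuousWithinAt

lemma exists_bound (hf : SmoothDecay α f f₁ f₂) :
    ∃ C, 0 ≤ C ∧ ∀ t, 0 ≤ t → ‖f t‖ ≤ C * (1 + t) ^ (-α) := by
  obtain ⟨C, hC⟩ := hf.decay
  exact ⟨C, by simpa using (norm_nonneg _).trans (hC 0 self_mem_Ici).1, fun t ht => (hC t ht).1⟩

lemma exists_bound_rpow (hf : SmoothDecay α f f₁ f₂) (hα : 0 ≤ α) :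
    ∃ C, 0 ≤ C ∧ (∀ t, 0 ≤ t → ‖f t‖ ≤ C) ∧ ∀ t, 0 < t → ‖f t‖ ≤ C * t ^ (-α) := by
  obtain ⟨C, hC0, hC⟩ := hf.exists_bound
  refine ⟨C, hC0, fun t ht => (hC t ht).trans ?_, fun t ht => (hC t ht.le).trans ?_⟩
  · exact mul_le_of_le_one_right hC0
      (Real.rpow_le_one_of_one_le_of_nonpos (by linarith) (by linarith))
  · exact mul_le_mul_of_nonneg_left
      (Real.rpow_le_rpow_of_nonpos ht (by linarith) (by linarith)) hC0

end SmoothDecay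

/-! ### Integrability, Mellin convergence and decay of the cosine transform -/

lemma integrableOn_of_bound_one_add_rpow {α : ℝ} (hα : 1 < α) {g : ℝ → ℂ} {C : ℝ}
    (hc : ContinuousOn g (Ici 0)) (hg : ∀ t, 0 ≤ t → ‖g t‖ ≤ C * (1 + t) ^ (-α)) :
    IntegrableOn g (Ioi 0) := by
  have h := (integrableOn_add_rpow_Ioi_of_lt (a := -α) (c := 0) (m := 1) (by linarith)
    (by norm_num)).const_mul C
  refine Integrable.mono' h ((hc.mono Ioi_subset_Ici_self).aestronglyMeasurable measurableSet_Ioi) ?_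
  filter_upwards [ae_restrict_mem measurableSet_Ioi] with t ht
  rw [add_comm t 1]
  exact hg t (le_of_lt ht)

namespace SmoothDecay

variable {α : ℝ} {f f₁ f₂ : ℝ → ℂ}

lemma integrableOn (hf : SmoothDecay α f f₁ f₂) (hα : 1 < α) : IntegrableOn f (Ioi 0) := by
  obtain ⟨C, hC⟩ := hf.decay
  exact integrableOn_of_bound_one_add_rpow hα hf.continuousOn fun t ht => (hC t ht).1

lemma integrableOn₂ (hf : SmoothDecay α f f₁ f₂) (hα : 1 < α) : IntegrableOn f₂ (Ioi 0) := by
  obtain ⟨C, hC⟩ := hf.decay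
  exact integrableOn_of_bound_one_add_rpow hα hf.cont₂ fun t ht => (hC t ht).2.2

lemma isBigO_atTop (hf : SmoothDecay α f f₁ f₂) (hα : 0 ≤ α) :
    f =O[atTop] fun t : ℝ => t ^ (-α) := by
  obtain ⟨C, -, -, hC⟩ := hf.exists_bound_rpow hα
  refine IsBigO.of_bound C ?_
  filter_upwards [eventually_gt_atTop 0] with t ht
  rw [Real.norm_of_nonneg (by positivity)]
  exact hC t ht

lemma isBigO_zero (hf : SmoothDecay α f f₁ f₂) (hα : 0 ≤ α) :
    f =O[nhdsWithin 0 (Ioi 0)] fun t : ℝ => t ^ (-(0 : ℝ)) := by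
  obtain ⟨C, -, hC, -⟩ := hf.exists_bound_rpow hα
  refine IsBigO.of_bound C ?_
  filter_upwards [self_mem_nhdsWithin] with t ht
  simpa using hC t (le_of_lt ht)

lemma locallyIntegrableOn (hf : SmoothDecay α f f₁ f₂) : LocallyIntegrableOn f (Ioi 0) :=
  (hf.continuousOn.mono Ioi_subset_Ici_self).locallyIntegrableOn measurableSet_Ioi

lemma mellinConvergent (hf : SmoothDecay α f f₁ f₂) (hα : 0 ≤ α) {s : ℂ} (hs : 0 < s.re)
    (hs' : s.re < α) : MellinConvergent f s :=
  mellinConvergent_of_isBigO_rpow hf.locallyIntegrableOn (hf.isBigO_atTop hα) hs'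
    (hf.isBigO_zero hα) hs

lemma integrableOn_rpow_mul_norm (hf : SmoothDecay α f f₁ f₂) (hα : 0 ≤ α) {s : ℝ} (hs : 0 < s)
    (hs' : s < α) : IntegrableOn (fun t => t ^ (s - 1) * ‖f t‖) (Ioi 0) := by
  have := (hf.mellinConvergent hα (s := s) (by simpa) (by simpa)).norm
  refine (integrableOn_congr_fun (fun t ht => ?_) measurableSet_Ioi).1 this
  rw [norm_smul, Complex.norm_cpow_eq_rpow_re_of_pos ht]
  simp

lemma integrableOn_mul_cos (hf : SmoothDecay α f f₁ f₂) (hα : 1 < α) (a : ℝ) :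
    IntegrableOn (fun t => f t * (Real.cos (a * t) : ℂ)) (Ioi 0) := by
  refine (hf.integrableOn hα).mul_bdd (c := 1) (by fun_prop) ?_
  filter_upwards with t
  rw [Complex.norm_real]
  exact Real.abs_cos_le_one _

/-- Two integrations by parts: the first boundary term vanishes with `sin` at `0`, the second leaves
`f₁ 0`. -/
lemma cosTransform_bound (hf : SmoothDecay α f f₁ f₂) (hα : 1 < α) :
    ∃ C, 0 ≤ C ∧ ∀ u, 0 < u → ‖cosTransform f u‖ ≤ C / u ^ 2 := by
  refine ⟨2 * (‖f₁ 0‖ + ∫ t in Ioi (0 : ℝ), ‖f₂ t‖), by positivity, fun u hu => ?_⟩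
  set a := 2 * Real.pi * u with ha
  have ha0 : 0 < a := by positivity
  have hau : u ≤ a := by
    have := Real.pi_gt_three
    nlinarith
  have hac : (a : ℂ) ≠ 0 := by exact_mod_cast ha0.ne'
  obtain ⟨C, hC⟩ := hf.decay
  have hi2 : IntegrableOn (fun t => f₂ t * (Real.cos (a * t) : ℂ)) (Ioi 0) := by
    refine (hf.integrableOn₂ hα).mul_bdd (c := 1) (by fun_prop) ?_
    filter_upwards with t
    rw [Complex.norm_real]
    exact Real.abs_cos_le_one _
  have hi0 := hf.integrableOn_mul_cos hα a
  have hlim : ∀ g : ℝ → ℂ, (∀ t, 0 ≤ t → ‖g t‖ ≤ C * (1 + t) ^ (-α)) →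
      Tendsto g atTop (nhds 0) := by
    intro g hg
    refine squeeze_zero_norm' ((eventually_ge_atTop 0).mono hg) ?_
    have := ((tendsto_rpow_neg_atTop (by linarith : 0 < α)).comp
      (tendsto_atTop_add_const_left atTop (1 : ℝ) tendsto_id)).const_mul C
    simpa [Function.comp_def] using this
  have hbd : ∀ g : ℝ → ℂ, Tendsto g atTop (nhds 0) → ∀ h : ℝ → ℝ, (∀ t, |h t| ≤ 1) →
      Tendsto (fun t => g t * (h t : ℂ)) atTop (nhds 0) := by
    intro g hg h hh
    refine squeeze_zero_norm (fun t => ?_) (tendsto_zero_iff_norm_tendsto_zero.1 hg)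
    rw [norm_mul, Complex.norm_real]
    exact mul_le_of_le_one_right (norm_nonneg _) (hh t)
  -- Both integrations by parts at once: the two `f₁ sin` terms cancel in the derivative of this
  -- primitive.
  have hFTC := integral_Ioi_of_hasDerivAt_of_tendsto (a := 0) (m := 0)
    (f := fun t => f t * (Real.sin (a * t) : ℂ) / a + f₁ t * (Real.cos (a * t) : ℂ) / a ^ 2)
    (f' := fun t => f t * (Real.cos (a * t) : ℂ) + f₂ t * (Real.cos (a * t) : ℂ) / a ^ 2)
    ?_ ?_ (hi0.add (hi2.div_const _)) ?_
  · rw [integral_add hi0 (hi2.div_const _), integral_div] at hFTC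
    have e : ∫ t in Ioi (0 : ℝ), f t * (Real.cos (a * t) : ℂ) =
        -(f₁ 0 + ∫ t in Ioi (0 : ℝ), f₂ t * (Real.cos (a * t) : ℂ)) / a ^ 2 := by
      simp only [mul_zero, Real.sin_zero, Real.cos_zero, Complex.ofReal_zero, Complex.ofReal_one,
        mul_one, zero_div, zero_add, zero_sub] at hFTC
      rw [neg_add, add_div, neg_div, ← hFTC]
      ring
    rw [cosTransform, e, norm_mul, norm_div, norm_neg, norm_pow, Complex.norm_real,
      Real.norm_of_nonneg ha0.le]
    have h1 : ‖f₁ 0 + ∫ t in Ioi (0 : ℝ), f₂ t * (Real.cos (a * t) : ℂ)‖ ≤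
        ‖f₁ 0‖ + ∫ t in Ioi (0 : ℝ), ‖f₂ t‖ := by
      refine (norm_add_le _ _).trans (add_le_add_right ?_ _)
      refine norm_integral_le_of_norm_le (hf.integrableOn₂ hα).norm ?_
      filter_upwards with t
      rw [norm_mul, Complex.norm_real]
      exact mul_le_of_le_one_right (norm_nonneg _) (Real.abs_cos_le_one _)
    rw [show ‖(2 : ℂ)‖ = 2 by simp, mul_div_assoc]
    gcongr
  · have h0 := hf.continuousOn 0 self_mem_Ici
    have h1 := hf.continuousOn₁ 0 self_mem_Ici
    exact ((h0.mul (by fun_prop)).div_const _).add ((h1.mul (by fun_prop)).div_const _)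
  · intro t ht
    have d0 := (hf.deriv₁ t (Ioi_subset_Ici_self ht)).hasDerivAt (Ici_mem_nhds ht)
    have d1 := (hf.deriv₂ t (Ioi_subset_Ici_self ht)).hasDerivAt (Ici_mem_nhds ht)
    have hl : HasDerivAt (fun t : ℝ => a * t) a t := by
      simpa using (hasDerivAt_id t).const_mul a
    have ds := hl.sin.ofReal_comp
    have dc := hl.cos.ofReal_comp
    refine (((d0.mul ds).div_const (a : ℂ)).add ((d1.mul dc).div_const ((a : ℂ) ^ 2))).congr_deriv ?_
    push_cast
    field_simp
    ring
  · have t0 := hbd f (hlim f fun t ht => (hC t ht).1) (fun t => Real.sin (a * t))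
      fun t => Real.abs_sin_le_one _
    have t1 := hbd f₁ (hlim f₁ fun t ht => (hC t ht).2.1) (fun t => Real.cos (a * t))
      fun t => Real.abs_cos_le_one _
    simpa using (t0.div_const (a : ℂ)).add (t1.div_const ((a : ℂ) ^ 2))

end SmoothDecay

/-! ### Poisson summation for the even extension -/

lemma cosTransform_zero (f : ℝ → ℂ) : cosTransform f 0 = 2 * ∫ t in Ioi (0 : ℝ), f t := by
  simp [cosTransform]

lemma cosTransform_neg (f : ℝ → ℂ) (u : ℝ) : cosTransform f (-u) = cosTransform f u := by
  simp [cosTransform]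

lemma cosTransform_comp_mul (f : ℝ → ℂ) {a : ℝ} (ha : 0 < a) (u : ℝ) :
    cosTransform (fun t => f (a * t)) u = (a⁻¹ : ℝ) * cosTransform f (u / a) := by
  have := integral_comp_mul_left_Ioi
    (fun t => f t * (Real.cos (2 * Real.pi * (u / a) * t) : ℂ)) 0 ha
  rw [mul_zero] at this
  rw [cosTransform, cosTransform, mul_left_comm, ← Complex.real_smul, ← this]
  congr 2
  ext t
  rw [show 2 * Real.pi * (u / a) * (a * t) = 2 * Real.pi * u * t by field_simp]

lemma tsum_nat_add_one_of_even {g : ℤ → ℂ} (hg : g.Even) (hs : Summable g) :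
    ∑' n, g n = g 0 + 2 * ∑' n : ℕ, g ((n + 1 : ℕ) : ℤ) := by
  rw [tsum_int_eq_zero_add_two_mul_tsum_pnat hg hs,
    tsum_pnat_eq_tsum_succ (f := fun n : ℕ => g n)]
  simp

namespace SmoothDecay

variable {α : ℝ} {f f₁ f₂ : ℝ → ℂ}

lemma fourier_abs (hf : SmoothDecay α f f₁ f₂) (hα : 1 < α) (u : ℝ) :
    FourierTransform.fourier (fun x : ℝ => f |x|) u = cosTransform f u := by
  have hint : ∀ v : ℝ, IntegrableOn
      (fun x : ℝ => Complex.exp (↑(-2 * Real.pi * x * v) * Complex.I) * f x) (Ioi 0) := by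
    intro v
    refine (hf.integrableOn hα).bdd_mul (c := 1) (by fun_prop) ?_
    filter_upwards with t
    rw [Complex.norm_exp_ofReal_mul_I]
  set g : ℝ → ℂ := fun x => Complex.exp (↑(-2 * Real.pi * x * u) * Complex.I) * f |x| with hg
  have hpos : ∀ x ∈ Ioi (0 : ℝ), g x =
      Complex.exp (↑(-2 * Real.pi * x * u) * Complex.I) * f x := fun x hx => by
    simp [hg, abs_of_pos (mem_Ioi.1 hx)]
  have hneg : ∀ x ∈ Ioi (0 : ℝ), g (-x) =
      Complex.exp (↑(-2 * Real.pi * x * (-u)) * Complex.I) * f x := fun x hx => by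
    simp [hg, abs_of_pos (mem_Ioi.1 hx)]
  have i1 : IntegrableOn g (Ioi 0) :=
    (integrableOn_congr_fun hpos measurableSet_Ioi).2 (hint u)
  have i2 : IntegrableOn (fun x => g (-x)) (Ioi 0) :=
    (integrableOn_congr_fun hneg measurableSet_Ioi).2 (hint (-u))
  have i3 : IntegrableOn g (Iic 0) := by
    rw [integrableOn_Iic_iff_integrableOn_Iio]
    have h := (Measure.measurePreserving_neg (volume : Measure ℝ)).integrableOn_comp_preimage
      (Homeomorph.neg ℝ).measurableEmbedding (f := g) (s := Iio 0)
    refine h.1 ?_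
    simpa [Function.comp_def] using i2
  rw [Real.fourier_real_eq_integral_exp_smul]
  simp only [smul_eq_mul]
  change ∫ x, g x = _
  rw [← intervalIntegral.integral_Iic_add_Ioi i3 i1]
  have h4 := integral_comp_neg_Ioi (0 : ℝ) g
  rw [neg_zero] at h4
  rw [← h4, ← integral_add i2 i1, cosTransform, ← integral_const_mul]
  refine setIntegral_congr_fun measurableSet_Ioi fun x hx => ?_
  simp only [hneg x hx, hpos x hx]
  have e1 : ((-2 * Real.pi * x * -u : ℝ) : ℂ) * Complex.I =
    ((2 * Real.pi * u * x : ℝ) : ℂ) * Complex.I := by push_cast; ring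
  have e2 : ((-2 * Real.pi * x * u : ℝ) : ℂ) * Complex.I =
    -((2 * Real.pi * u * x : ℝ) : ℂ) * Complex.I := by push_cast; ring
  rw [e1, e2, ← add_mul, ← Complex.two_cos, Complex.ofReal_cos]
  ring

lemma continuous_abs (hf : SmoothDecay α f f₁ f₂) : Continuous fun x : ℝ => f |x| :=
  hf.continuousOn.comp_continuous (by fun_prop) fun x => abs_nonneg x

/-- Poisson's summation formula for the even extension of `f`. -/
lemma poisson (hf : SmoothDecay α f f₁ f₂) (hα : 1 < α) :
    ∑' n : ℕ, f (n + 1) = -(f 0) / 2 + ((∫ t in Ioi (0 : ℝ), f t) +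
      ∑' n : ℕ, cosTransform f (n + 1)) := by
  have hO : (fun x : ℝ => f |x|) =O[cocompact ℝ] fun x : ℝ => |x| ^ (-α) := by
    have := (hf.isBigO_atTop (by linarith)).comp_tendsto (tendsto_norm_cocompact_atTop (E := ℝ))
    exact this
  obtain ⟨C, hC0, hC⟩ := hf.cosTransform_bound hα
  have hF : ∀ n : ℤ, FourierTransform.fourier (fun x : ℝ => f |x|) n = cosTransform f n :=
    fun n => hf.fourier_abs hα n
  have hev : Function.Even fun n : ℤ => cosTransform f n := fun n => by
    simp [cosTransform_neg]
  have hev' : Function.Even fun n : ℤ => f |(n : ℝ)| := fun n => by simp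
  have hs : Summable fun n : ℤ => cosTransform f n := by
    have hb : (fun n : ℤ => cosTransform f n) =O[cofinite] fun n : ℤ => |(n : ℝ)| ^ (-2 : ℝ) := by
      refine IsBigO.of_bound C ?_
      filter_upwards [(Set.finite_singleton (0 : ℤ)).compl_mem_cofinite] with n hn
      have hn' : (n : ℝ) ≠ 0 := by exact_mod_cast hn
      have h := hC |(n : ℝ)| (abs_pos.2 hn')
      have e : cosTransform f |(n : ℝ)| = cosTransform f n := by
        rcases abs_choice (n : ℝ) with h | h <;> rw [h]
        exact cosTransform_neg f n
      rw [e] at h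
      refine h.trans (le_of_eq ?_)
      rw [Real.norm_of_nonneg (by positivity), Real.rpow_neg (abs_nonneg _), div_eq_mul_inv]
      norm_cast
    exact summable_of_isBigO (Real.summable_abs_int_rpow one_lt_two) hb
  have hs' : Summable fun n : ℤ => f |(n : ℝ)| :=
    summable_of_isBigO (Real.summable_abs_int_rpow hα)
      (hO.comp_tendsto Int.tendsto_coe_cofinite)
  have hp := Real.tsum_eq_tsum_fourier_of_rpow_decay_of_summable hf.continuous_abs hα hO
    (by simpa only [hF] using hs) 0
  simp only [hF, zero_add] at hp
  have h0 : ∀ n : ℤ, fourier n ((0 : ℝ) : UnitAddCircle) = 1 := fun n => by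
    simp
  simp only [h0, mul_one] at hp
  rw [tsum_nat_add_one_of_even hev' hs', tsum_nat_add_one_of_even hev hs] at hp
  simp only [Int.cast_zero, abs_zero, cosTransform_zero] at hp
  have e1 : ∑' n : ℕ, f |(((n + 1 : ℕ) : ℤ) : ℝ)| = ∑' n : ℕ, f (n + 1) :=
    tsum_congr fun n => by
      congr 1
      push_cast
      exact abs_of_nonneg (by positivity)
  have e2 : ∑' n : ℕ, cosTransform f (((n + 1 : ℕ) : ℤ) : ℝ) =
      ∑' n : ℕ, cosTransform f (n + 1) := tsum_congr fun n => by push_cast; rfl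
  rw [e1, e2] at hp
  linear_combination hp / 2

lemma poisson_comp_mul (hf : SmoothDecay α f f₁ f₂) (hα : 1 < α) {t : ℝ} (ht : 0 < t) :
    ∑' n : ℕ, f (t * (n + 1)) = -(f 0) / 2 + (t⁻¹ : ℝ) * ((∫ y in Ioi (0 : ℝ), f y) +
      ∑' n : ℕ, cosTransform f ((n + 1) / t)) := by
  have h := (hf.comp_mul (by linarith) 1 ht).poisson hα
  simp only [one_mul, cosTransform_comp_mul f ht, tsum_mul_left, mul_zero] at h
  have e := integral_comp_mul_left_Ioi f 0 ht
  rw [mul_zero] at e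
  rw [h, e, mul_add, Complex.real_smul]

lemma tendsto_cosTransform_zero (hf : SmoothDecay α f f₁ f₂) (hα : 1 < α) :
    Tendsto (cosTransform f) (nhdsWithin 0 (Ioi 0)) (nhds (2 * ∫ t in Ioi (0 : ℝ), f t)) := by
  refine Tendsto.const_mul 2 ?_
  refine tendsto_integral_filter_of_dominated_convergence (fun t => ‖f t‖) ?_ ?_
    (hf.integrableOn hα).norm ?_
  · exact Eventually.of_forall fun u => (hf.integrableOn_mul_cos hα _).aestronglyMeasurable
  · refine Eventually.of_forall fun u => Eventually.of_forall fun t => ?_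
    rw [norm_mul, Complex.norm_real]
    exact mul_le_of_le_one_right (norm_nonneg _) (Real.abs_cos_le_one _)
  · refine Eventually.of_forall fun t => ?_
    have hc : Continuous fun u : ℝ => f t * (Real.cos (2 * Real.pi * u * t) : ℂ) := by fun_prop
    have := (hc.tendsto 0).mono_left (nhdsWithin_le_nhds (s := Ioi (0 : ℝ)))
    simpa using this

end SmoothDecay

/-! ### The pair `f`, `H` and its vanishing conditions -/

/-- `f` and `H` are in the class, and `H(v) = v⁻¹ f̂(v⁻¹)` for `v > 0`, with `f̂` the cosine
transform of `f`. -/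
structure CosPair (α : ℝ) (f H : ℝ → ℂ) : Prop where
  left : ∃ f₁ f₂, SmoothDecay α f f₁ f₂
  right : ∃ H₁ H₂, SmoothDecay α H H₁ H₂
  eq : ∀ v, 0 < v → H v = (v⁻¹ : ℝ) * cosTransform f v⁻¹

namespace CosPair

variable {α : ℝ} {f H : ℝ → ℂ}

lemma comp_mul (h : CosPair α f H) (hα : 0 ≤ α) {a : ℝ} (ha : 0 < a) :
    CosPair α (fun t => f (a * t)) (fun t => H (a * t)) := by
  obtain ⟨f₁, f₂, hf⟩ := h.left
  obtain ⟨H₁, H₂, hH⟩ := h.right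
  have hf' := hf.comp_mul hα 1 ha
  have hH' := hH.comp_mul hα 1 ha
  simp only [one_mul] at hf' hH'
  refine ⟨⟨_, _, hf'⟩, ⟨_, _, hH'⟩, fun v hv => ?_⟩
  rw [cosTransform_comp_mul f ha, h.eq _ (by positivity), mul_inv_rev, ← mul_assoc,
    ← Complex.ofReal_mul, div_eq_mul_inv]

lemma cosTransform_eq (h : CosPair α f H) {u : ℝ} (hu : 0 < u) :
    cosTransform f u = (u⁻¹ : ℝ) * H u⁻¹ := by
  rw [h.eq _ (inv_pos.2 hu), inv_inv, ← mul_assoc, ← Complex.ofReal_mul, inv_mul_cancel₀ hu.ne']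
  simp

/-- The inversion `v ↦ v⁻¹` turns the decay `f̂(u) = O(u⁻²)` at infinity into vanishing of `H` at
`0`. This later makes `∑ k⁻¹ H(t/k)` converge like `∑ k⁻²`. -/
lemma exists_bound_mul (h : CosPair α f H) (hα : 1 < α) :
    ∃ C, 0 ≤ C ∧ ∀ v, 0 < v → ‖H v‖ ≤ C * v := by
  obtain ⟨f₁, f₂, hf⟩ := h.left
  obtain ⟨C, hC0, hC⟩ := hf.cosTransform_bound hα
  refine ⟨C, hC0, fun v hv => ?_⟩
  rw [h.eq v hv, norm_mul, Complex.norm_real, Real.norm_of_nonneg (by positivity)]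
  calc v⁻¹ * ‖cosTransform f v⁻¹‖ ≤ v⁻¹ * (C / v⁻¹ ^ 2) := by
        gcongr; exact hC _ (inv_pos.2 hv)
    _ = C * v := by field_simp

lemma apply_zero (h : CosPair α f H) (hα : 1 < α) : H 0 = 0 := by
  obtain ⟨H₁, H₂, hH⟩ := h.right
  obtain ⟨C, -, hC⟩ := h.exists_bound_mul hα
  have h1 : Tendsto H (nhdsWithin 0 (Ioi 0)) (nhds (H 0)) :=
    (hH.continuousOn 0 self_mem_Ici).mono_left (nhdsWithin_mono _ Ioi_subset_Ici_self)
  refine tendsto_nhds_unique h1 ?_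
  refine squeeze_zero_norm' (a := fun v => C * v) ?_ ?_
  · filter_upwards [self_mem_nhdsWithin] with v hv using hC v hv
  · have : Continuous fun v : ℝ => C * v := by fun_prop
    simpa using (this.tendsto 0).mono_left (nhdsWithin_le_nhds (s := Ioi (0 : ℝ)))

/-- The decay of `H` at infinity says `f̂(u) = O(u^(α-1))` as `u → 0`, while `f̂(u)` tends to `2 ∫
f`. -/
lemma integral_eq_zero (h : CosPair α f H) (hα : 1 < α) : ∫ t in Ioi (0 : ℝ), f t = 0 := by
  obtain ⟨f₁, f₂, hf⟩ := h.left
  obtain ⟨H₁, H₂, hH⟩ := h.right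
  obtain ⟨C, hC0, -, hC⟩ := hH.exists_bound_rpow (by linarith)
  have h0 : Tendsto (cosTransform f) (nhdsWithin 0 (Ioi 0)) (nhds 0) := by
    refine squeeze_zero_norm' (a := fun u => C * u ^ (α - 1)) ?_ ?_
    · filter_upwards [self_mem_nhdsWithin] with u hu
      have hu : 0 < u := hu
      rw [h.cosTransform_eq hu, norm_mul, Complex.norm_real, Real.norm_of_nonneg (by positivity)]
      calc u⁻¹ * ‖H u⁻¹‖ ≤ u⁻¹ * (C * u⁻¹ ^ (-α)) := by
            gcongr; exact hC _ (inv_pos.2 hu)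
        _ = C * u ^ (α - 1) := by
            rw [Real.inv_rpow hu.le, Real.rpow_neg hu.le, inv_inv, Real.rpow_sub_one hu.ne']
            ring
    · have : Tendsto (fun u : ℝ => u ^ (α - 1)) (nhds 0) (nhds (0 ^ (α - 1))) :=
        (Real.continuousAt_rpow_const 0 (α - 1) (Or.inr (by linarith))).tendsto
      rw [Real.zero_rpow (by linarith)] at this
      simpa using (this.mono_left (nhdsWithin_le_nhds (s := Ioi (0 : ℝ)))).const_mul C
  have := tendsto_nhds_unique (hf.tendsto_cosTransform_zero hα) h0
  simpa using this

end CosPair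

/-! ### Trapezoidal rule and dilation sums -/

/-- The error of the trapezoidal rule with step `1` on `[0, M]`. -/
noncomputable def trapezoidError (φ : ℝ → ℂ) (M : ℕ) : ℂ :=
  ∑ m ∈ Finset.range M, (φ m + φ (m + 1)) / 2 - ∫ t in (0 : ℝ)..M, φ t

lemma sum_average_eq (φ : ℝ → ℂ) (M : ℕ) :
    ∑ m ∈ Finset.range M, (φ m + φ (m + 1)) / 2 =
      ∑ m ∈ Finset.range M, φ (m + 1) + (φ 0 - φ M) / 2 := by
  induction M with
  | zero => simp
  | succ n ih => rw [Finset.sum_range_succ, Finset.sum_range_succ, ih]; push_cast; ring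

/-- The dilation sum `t ↦ ∑_{k ≥ 1} f(kt)`. -/
noncomputable def dilationSum (f : ℝ → ℂ) (t : ℝ) : ℂ := ∑' k : ℕ, f (t * (k + 1))

namespace SmoothDecay

variable {α : ℝ} {f f₁ f₂ : ℝ → ℂ}

lemma intervalIntegrable (hf : SmoothDecay α f f₁ f₂) {a b : ℝ} (ha : 0 ≤ a) (hb : 0 ≤ b) :
    IntervalIntegrable f volume a b :=
  (hf.continuousOn.mono fun _ ht => (le_min ha hb).trans ht.1).intervalIntegrable

/-- The error is the integral of `f₂` against the Peano kernel `(t - a)(a + 1 - t)/2`, whose values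
lie in `[0, 1]`. -/
lemma norm_trapezoid_unit_le (hf : SmoothDecay α f f₁ f₂) {a : ℝ} (ha : 0 ≤ a) :
    ‖(f a + f (a + 1)) / 2 - ∫ t in a..(a + 1), f t‖ ≤ ∫ t in a..(a + 1), ‖f₂ t‖ := by
  have hab : a ≤ a + 1 := by linarith
  have hsub : Icc a (a + 1) ⊆ Ici 0 := fun t ht => ha.trans ht.1
  have hsub' : uIcc a (a + 1) ⊆ Ici 0 := by rwa [uIcc_of_le hab]
  have c0 := hf.continuousOn.mono hsub
  have c1 := hf.continuousOn₁.mono hsub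
  have c2 := hf.cont₂.mono hsub'
  have i0 := hf.intervalIntegrable ha (ha.trans hab)
  have i2 : IntervalIntegrable (fun t : ℝ => ((t - a) * (a + 1 - t) / 2 : ℂ) * f₂ t)
      volume a (a + 1) :=
    (ContinuousOn.mul (by fun_prop) c2).intervalIntegrable
  have h := intervalIntegral.integral_eq_sub_of_hasDerivAt_of_le hab
    (f := fun t : ℝ => (t - a - 1 / 2 : ℂ) * f t + ((t - a) * (a + 1 - t) / 2 : ℂ) * f₁ t)
    (f' := fun t : ℝ => f t + ((t - a) * (a + 1 - t) / 2 : ℂ) * f₂ t) ?_ ?_ (i0.add i2)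
  · rw [intervalIntegral.integral_add i0 i2] at h
    have e : (f a + f (a + 1)) / 2 - ∫ t in a..(a + 1), f t =
        ∫ t in a..(a + 1), ((t - a) * (a + 1 - t) / 2 : ℂ) * f₂ t := by
      push_cast at h
      linear_combination -h
    rw [e]
    refine intervalIntegral.norm_integral_le_of_norm_le hab ?_ c2.norm.intervalIntegrable
    refine Eventually.of_forall fun t ht => ?_
    rw [norm_mul]
    refine mul_le_of_le_one_left (norm_nonneg _) ?_
    have : ((t - a) * (a + 1 - t) / 2 : ℂ) = (((t - a) * (a + 1 - t) / 2 : ℝ) : ℂ) := by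
      push_cast; ring
    rw [this, Complex.norm_real, Real.norm_eq_abs, abs_le]
    obtain ⟨h1, h2⟩ := ht
    constructor <;> nlinarith
  · exact (ContinuousOn.mul (by fun_prop) c0).add (ContinuousOn.mul (by fun_prop) c1)
  · intro t ht
    have ht0 : 0 < t := ha.trans_lt ht.1
    have d0 := (hf.deriv₁ t ht0.le).hasDerivAt (Ici_mem_nhds ht0)
    have d1 := (hf.deriv₂ t ht0.le).hasDerivAt (Ici_mem_nhds ht0)
    have hid : HasDerivAt (fun t : ℝ => (t : ℂ)) 1 t := (hasDerivAt_id t).ofReal_comp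
    have p0 := (hid.sub_const (a : ℂ)).sub_const (1 / 2 : ℂ)
    have p1 := ((hid.sub_const (a : ℂ)).mul (hid.const_sub (a + 1 : ℂ))).div_const 2
    refine ((p0.mul d0).add (p1.mul d1)).congr_deriv ?_
    simp only [Pi.mul_apply]
    ring

lemma norm_trapezoidError_le (hf : SmoothDecay α f f₁ f₂) (hα : 1 < α) (M : ℕ) :
    ‖trapezoidError f M‖ ≤ ∫ t in Ioi (0 : ℝ), ‖f₂ t‖ := by
  have i0 : ∀ k < M, IntervalIntegrable f volume (k : ℝ) ((k + 1 : ℕ) : ℝ) := fun k _ =>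
    hf.intervalIntegrable (by positivity) (by positivity)
  have i2 : ∀ k < M, IntervalIntegrable (fun t => ‖f₂ t‖) volume (k : ℝ) ((k + 1 : ℕ) : ℝ) :=
    fun k _ => (hf.cont₂.norm.mono fun t ht =>
      (le_min (by positivity) (by positivity)).trans ht.1).intervalIntegrable
  have s0 := intervalIntegral.sum_integral_adjacent_intervals (a := fun k : ℕ => (k : ℝ)) i0
  have s2 := intervalIntegral.sum_integral_adjacent_intervals (a := fun k : ℕ => (k : ℝ)) i2
  simp only [Nat.cast_zero] at s0 s2
  rw [trapezoidError, ← s0, ← Finset.sum_sub_distrib]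
  calc ‖_‖ ≤ ∑ k ∈ Finset.range M, ∫ t in (k : ℝ)..((k + 1 : ℕ) : ℝ), ‖f₂ t‖ := by
        refine norm_sum_le_of_le _ fun k _ => ?_
        push_cast
        exact hf.norm_trapezoid_unit_le (by positivity)
    _ = ∫ t in (0 : ℝ)..M, ‖f₂ t‖ := s2
    _ ≤ _ := by
        rw [intervalIntegral.integral_of_le (by positivity)]
        exact setIntegral_mono_set (hf.integrableOn₂ hα).norm
          (Eventually.of_forall fun t => norm_nonneg _) Ioc_subset_Ioi_self.eventuallyLE

lemma tendsto_zero (hf : SmoothDecay α f f₁ f₂) (hα : 0 < α) : Tendsto f atTop (nhds 0) :=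
  (hf.isBigO_atTop hα.le).trans_tendsto (tendsto_rpow_neg_atTop hα)

lemma exists_bound_dilation (hf : SmoothDecay α f f₁ f₂) (hα : 1 < α) :
    ∃ C, 0 ≤ C ∧ ∀ (k : ℕ) (t : ℝ), 0 < t →
      ‖f (t * (k + 1))‖ ≤ C * t ^ (-α) * ((k : ℝ) + 1) ^ (-α) := by
  obtain ⟨C, hC0, -, hC⟩ := hf.exists_bound_rpow (by linarith)
  refine ⟨C, hC0, fun k t ht => ?_⟩
  have := hC (t * (k + 1)) (by positivity)
  rwa [Real.mul_rpow ht.le (by positivity), ← mul_assoc] at this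

end SmoothDecay

lemma summable_nat_add_one_rpow_neg {α : ℝ} (hα : 1 < α) :
    Summable fun k : ℕ => ((k : ℝ) + 1) ^ (-α) := by
  have := (summable_nat_add_iff 1).2 (Real.summable_nat_rpow.2 (by linarith : -α < -1))
  simpa using this

namespace SmoothDecay

variable {α : ℝ} {f f₁ f₂ : ℝ → ℂ}

lemma summable_dilation (hf : SmoothDecay α f f₁ f₂) (hα : 1 < α) {t : ℝ} (ht : 0 < t) :
    Summable fun k : ℕ => f (t * (k + 1)) := by
  obtain ⟨C, -, hC⟩ := hf.exists_bound_dilation hα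
  exact Summable.of_norm_bounded ((summable_nat_add_one_rpow_neg hα).mul_left _)
    fun k => hC k t ht

lemma exists_bound_dilationSum (hf : SmoothDecay α f f₁ f₂) (hα : 1 < α) :
    ∃ C, 0 ≤ C ∧ ∀ t, 0 < t → ‖dilationSum f t‖ ≤ C * t ^ (-α) := by
  obtain ⟨C, hC0, hC⟩ := hf.exists_bound_dilation hα
  refine ⟨C * ∑' k : ℕ, ((k : ℝ) + 1) ^ (-α),
    mul_nonneg hC0 (tsum_nonneg fun k => by positivity), fun t ht => ?_⟩
  refine (tsum_of_norm_bounded ((summable_nat_add_one_rpow_neg hα).mul_left _).hasSum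
    fun k => hC k t ht).trans (le_of_eq ?_)
  rw [tsum_mul_left]
  ring

/-- The errors tend to `∑ f(n) - ∫ f` because `f` vanishes at `0` and at infinity, and Poisson's
formula evaluates this difference. -/
lemma tendsto_trapezoidError (hf : SmoothDecay α f f₁ f₂) (hα : 1 < α) (h0 : f 0 = 0) :
    Tendsto (trapezoidError f) atTop (nhds (∑' n : ℕ, cosTransform f (n + 1))) := by
  have hp := hf.poisson hα
  rw [h0, neg_zero, zero_div, zero_add] at hp
  have hs := hf.summable_dilation hα one_pos
  simp only [one_mul] at hs
  have h1 := hs.hasSum.tendsto_sum_nat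
  have h2 := intervalIntegral_tendsto_integral_Ioi 0 (hf.integrableOn hα)
    tendsto_natCast_atTop_atTop
  have h3 := ((hf.tendsto_zero (by linarith)).comp
    (tendsto_natCast_atTop_atTop (R := ℝ))).const_sub (0 : ℂ)
  have h4 := (h1.add (h3.div_const 2)).sub h2
  refine (h4.congr fun M => ?_).trans (le_of_eq ?_)
  · rw [trapezoidError, sum_average_eq, h0]
    rfl
  · rw [hp]; congr 1; ring

end SmoothDecay

/-! ### The second Poisson summation -/

namespace CosPair

variable {α : ℝ} {f H : ℝ → ℂ}

/-- Poisson's formula for `f` in terms of `H`. -/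
lemma dilationSum_eq (h : CosPair α f H) (hα : 1 < α) {t : ℝ} (ht : 0 < t) :
    dilationSum f t = -(f 0) / 2 +
      ∑' k : ℕ, ((((k : ℝ) + 1)⁻¹ : ℝ) : ℂ) * H (((k : ℝ) + 1)⁻¹ * t) := by
  obtain ⟨f₁, f₂, hf⟩ := h.left
  rw [dilationSum, hf.poisson_comp_mul hα ht, h.integral_eq_zero hα, zero_add, ← tsum_mul_left]
  congr 1
  refine tsum_congr fun k => ?_
  rw [h.cosTransform_eq (by positivity), ← mul_assoc, ← Complex.ofReal_mul, inv_div, div_eq_inv_mul]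
  congr 2
  field_simp

/-- Trapezoidal summation of Poisson's formula for `f`. -/
lemma tsum_dilationSum (h : CosPair α f H) (hα : 1 < α) :
    (Summable fun m : ℕ => dilationSum f (m + 1)) ∧ IntegrableOn (dilationSum f) (Ioi 0) ∧
    (∃ C, ∀ t, 0 < t → t ≤ 1 → ‖dilationSum f t‖ ≤ C) ∧
    ∑' m : ℕ, dilationSum f (m + 1) - ∫ t in Ioi (0 : ℝ), dilationSum f t =
      f 0 / 4 + ∑' k : ℕ, ∑' m : ℕ, cosTransform H (((k : ℝ) + 1) * (m + 1)) := by
  obtain ⟨f₁, f₂, hf⟩ := h.left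
  obtain ⟨H₁, H₂, hH⟩ := h.right
  obtain ⟨C, hC0, hC⟩ := h.exists_bound_mul hα
  have hH0 := h.apply_zero hα
  set A : ℕ → ℝ → ℂ := fun k t => ((((k : ℝ) + 1)⁻¹ : ℝ) : ℂ) * H (((k : ℝ) + 1)⁻¹ * t) with hA
  have hAs := fun k : ℕ => hH.comp_mul (by linarith) ((((k : ℝ) + 1)⁻¹ : ℝ) : ℂ)
    (a := ((k : ℝ) + 1)⁻¹) (by positivity)
  have hA0 : ∀ k, A k 0 = 0 := fun k => by simp [hA, hH0]
  have hsq : Summable fun k : ℕ => ((k : ℝ) + 1) ^ (-2 : ℝ) :=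
    summable_nat_add_one_rpow_neg one_lt_two
  have hsq_eq : ∀ k : ℕ, ((k : ℝ) + 1) ^ (-2 : ℝ) = ((k : ℝ) + 1)⁻¹ * ((k : ℝ) + 1)⁻¹ := by
    intro k
    rw [Real.rpow_neg (by positivity), ← mul_inv, ← sq]
    norm_cast
  -- One factor `(k + 1)⁻¹` is explicit in `A k`, the other comes from `H(v) = O(v)`.
  have hAb : ∀ k t, 0 ≤ t → ‖A k t‖ ≤ C * t * ((k : ℝ) + 1) ^ (-2 : ℝ) := by
    intro k t ht
    rcases ht.eq_or_lt with rfl | ht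
    · simp [hA0]
    · rw [norm_mul, Complex.norm_real, Real.norm_of_nonneg (by positivity), hsq_eq]
      have := hC (((k : ℝ) + 1)⁻¹ * t) (by positivity)
      calc _ ≤ ((k : ℝ) + 1)⁻¹ * (C * (((k : ℝ) + 1)⁻¹ * t)) := by gcongr
        _ = _ := by ring
  have hAsum : ∀ t, 0 ≤ t → Summable fun k => A k t := fun t ht =>
    Summable.of_norm_bounded (hsq.mul_left _) fun k => hAb k t ht
  set B : ℝ → ℂ := fun t => ∑' k, A k t with hB
  have hFB : ∀ t, 0 < t → dilationSum f t = -(f 0) / 2 + B t := fun t ht => h.dilationSum_eq hα ht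
  have hB0 : B 0 = 0 := by simp [hB, hA0]
  have hBb : ∀ t, 0 ≤ t → ‖B t‖ ≤ C * t * ∑' k : ℕ, ((k : ℝ) + 1) ^ (-2 : ℝ) := fun t ht => by
    rw [← tsum_mul_left]
    exact tsum_of_norm_bounded (hsq.mul_left _).hasSum fun k => hAb k t ht
  have hAc : ∀ k, ContinuousOn (A k) (Ici 0) := fun k => (hAs k).continuousOn
  -- The bound on `A k` grows with `t`, so uniform convergence is used on `[0, t + 1)` only.
  have hBc : ContinuousOn B (Ici 0) := by
    intro t ht
    have hc : ContinuousOn B (Ico 0 (t + 1)) := by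
      refine continuousOn_tsum (u := fun k : ℕ => C * (t + 1) * ((k : ℝ) + 1) ^ (-2 : ℝ))
        (fun k => (hAc k).mono Ico_subset_Ici_self) (hsq.mul_left _) fun k s hs => ?_
      refine (hAb k s hs.1).trans ?_
      gcongr
      exact hs.2.le
    refine (hc t ⟨ht, by linarith⟩).mono_of_mem_nhdsWithin ?_
    rw [← Ici_inter_Iio]
    exact inter_mem self_mem_nhdsWithin (mem_nhdsWithin_of_mem_nhds (Iio_mem_nhds (by linarith)))
  have hFc : ContinuousOn (dilationSum f) (Ioi 0) :=
    (continuousOn_const.add (hBc.mono Ioi_subset_Ici_self)).congr fun t ht => hFB t ht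
  obtain ⟨D, hD0, hD⟩ := hf.exists_bound_dilationSum hα
  set S := ∑' k : ℕ, ((k : ℝ) + 1) ^ (-2 : ℝ)
  have hS : 0 ≤ S := tsum_nonneg fun k => by positivity
  have hFb : ∀ t, 0 < t → t ≤ 1 → ‖dilationSum f t‖ ≤ ‖f 0‖ / 2 + C * S := by
    intro t ht ht1
    rw [hFB t ht]
    refine (norm_add_le _ _).trans (add_le_add (by simp) ((hBb t ht.le).trans ?_))
    gcongr
    exact mul_le_of_le_one_right hC0 ht1
  have hFi1 : IntegrableOn (dilationSum f) (Ioc 0 1) := by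
    refine Integrable.of_bound
      ((hFc.mono Ioc_subset_Ioi_self).aestronglyMeasurable measurableSet_Ioc)
      (‖f 0‖ / 2 + C * S) ?_
    filter_upwards [ae_restrict_mem measurableSet_Ioc] with t ht
    exact hFb t ht.1 ht.2
  have hFi2 : IntegrableOn (dilationSum f) (Ioi 1) := by
    refine Integrable.mono' ((integrableOn_Ioi_rpow_of_lt (by linarith : -α < -1)
      one_pos).const_mul D) ((hFc.mono (Ioi_subset_Ioi zero_le_one)).aestronglyMeasurable
        measurableSet_Ioi) ?_
    filter_upwards [ae_restrict_mem measurableSet_Ioi] with t ht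
    exact hD t (one_pos.trans ht)
  have hFi : IntegrableOn (dilationSum f) (Ioi 0) := by
    rw [← Ioc_union_Ioi_eq_Ioi (zero_le_one (α := ℝ))]
    exact hFi1.union hFi2
  have hFs : Summable fun m : ℕ => dilationSum f (m + 1) :=
    Summable.of_norm_bounded ((summable_nat_add_one_rpow_neg hα).mul_left D)
      fun m => hD _ (by positivity)
  refine ⟨hFs, hFi, ⟨_, hFb⟩, ?_⟩
  -- For fixed `M` the trapezoidal error involves only `[0, M]`, where the series for `B` is
  -- dominated by `C M (k + 1)⁻²`.
  have hTsum : ∀ M, HasSum (fun k => trapezoidError (A k) M) (trapezoidError B M) := by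
    intro M
    refine HasSum.sub (hasSum_sum fun m _ => ((hAsum m (by positivity)).hasSum.add
      (hAsum (m + 1) (by positivity)).hasSum).div_const 2) ?_
    refine intervalIntegral.hasSum_integral_of_dominated_convergence
      (bound := fun (k : ℕ) (_ : ℝ) => C * M * ((k : ℝ) + 1) ^ (-2 : ℝ)) ?_ ?_ ?_ ?_ ?_
    · intro k
      refine ((hAc k).mono fun t ht => ?_).aestronglyMeasurable measurableSet_uIoc
      rw [uIoc_of_le (by positivity)] at ht
      exact ht.1.le
    · intro k
      refine Eventually.of_forall fun t ht => ?_
      rw [uIoc_of_le (by positivity)] at ht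
      refine (hAb k t ht.1.le).trans ?_
      gcongr
      exact ht.2
    · exact Eventually.of_forall fun t _ => hsq.mul_left _
    · simp
    · refine Eventually.of_forall fun t ht => ?_
      rw [uIoc_of_le (by positivity)] at ht
      exact (hAsum t ht.1.le).hasSum
  have hAl : ∀ k, Tendsto (trapezoidError (A k)) atTop
      (nhds (∑' m : ℕ, cosTransform H (((k : ℝ) + 1) * (m + 1)))) := by
    intro k
    refine ((hAs k).tendsto_trapezoidError hα (hA0 k)).trans (le_of_eq ?_)
    congr 1
    refine tsum_congr fun m => ?_
    have hk : ((((k : ℝ) + 1)⁻¹ : ℝ) : ℂ) * ((((k : ℝ) + 1)⁻¹⁻¹ : ℝ) : ℂ) = 1 := by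
      rw [← Complex.ofReal_mul, mul_inv_cancel₀ (by positivity), Complex.ofReal_one]
    have := cosTransform_comp_mul H (a := ((k : ℝ) + 1)⁻¹) (by positivity) (m + 1)
    calc cosTransform (A k) (m + 1)
        = ((((k : ℝ) + 1)⁻¹ : ℝ) : ℂ) *
          cosTransform (fun t => H (((k : ℝ) + 1)⁻¹ * t)) (m + 1) := by
          simp only [cosTransform, hA, mul_assoc, integral_const_mul]
          ring
      _ = _ := by
          rw [this, ← mul_assoc, hk, one_mul, div_inv_eq_mul, mul_comm]
  -- Dominated convergence in `k`. In the bound `∫ |A k''|`, the prefactor gives `(k + 1)⁻¹`, two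
  -- derivatives give `(k + 1)⁻²`, and the change of variables gives back `k + 1`.
  have hlim1 : Tendsto (trapezoidError B) atTop
      (nhds (∑' k : ℕ, ∑' m : ℕ, cosTransform H (((k : ℝ) + 1) * (m + 1)))) := by
    have := tendsto_tsum_of_dominated_convergence
      (hsq.mul_right (∫ t in Ioi (0 : ℝ), ‖H₂ t‖)) hAl (Eventually.of_forall fun M k => by
        refine ((hAs k).norm_trapezoidError_le hα M).trans (le_of_eq ?_)
        have e := integral_comp_mul_left_Ioi (fun t => ‖H₂ t‖) 0
          (by positivity : 0 < ((k : ℝ) + 1)⁻¹)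
        rw [mul_zero] at e
        simp only [norm_mul, Complex.norm_real]
        rw [Real.norm_of_nonneg (by positivity), integral_const_mul, integral_const_mul,
          integral_const_mul, e, smul_eq_mul, hsq_eq]
        field_simp)
    exact this.congr fun M => (hTsum M).tsum_eq
  -- Substitute `B = F + f(0)/2`, valid for `t > 0` only. The terms linear in `M` cancel. Since `B 0
  -- = 0`, only the endpoint `M` contributes its half weight, which leaves `-f(0)/4`.
  have hlim2 : Tendsto (trapezoidError B) atTop
      (nhds (∑' m : ℕ, dilationSum f (m + 1) + (0 - 0) / 2 - f 0 / 4 -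
        ∫ t in Ioi (0 : ℝ), dilationSum f t)) := by
    have l1 := hFs.hasSum.tendsto_sum_nat
    have l2 := intervalIntegral_tendsto_integral_Ioi 0 hFi (tendsto_natCast_atTop_atTop (R := ℝ))
    have l3 : Tendsto (fun M : ℕ => dilationSum f M) atTop (nhds 0) := by
      refine squeeze_zero_norm' (a := fun M : ℕ => D * (M : ℝ) ^ (-α)) ?_ ?_
      · filter_upwards [eventually_gt_atTop 0] with M hM
        exact hD _ (by exact_mod_cast hM)
      · simpa using ((tendsto_rpow_neg_atTop (by linarith : 0 < α)).comp
          (tendsto_natCast_atTop_atTop (R := ℝ))).const_mul D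
    refine (((l1.add ((l3.const_sub 0).div_const 2)).sub_const (f 0 / 4)).sub l2).congr' ?_
    filter_upwards [eventually_gt_atTop 0] with M hM
    have hM' : (0 : ℝ) < M := by exact_mod_cast hM
    have hi : ∫ t in (0 : ℝ)..M, dilationSum f t = -(f 0) / 2 * M + ∫ t in (0 : ℝ)..M, B t := by
      have hBi : IntervalIntegrable B volume 0 M :=
        (hBc.mono fun t ht => by rw [uIcc_of_le hM'.le] at ht; exact ht.1).intervalIntegrable
      have : ∫ t in (0 : ℝ)..M, dilationSum f t = ∫ t in (0 : ℝ)..M, (-(f 0) / 2 + B t) := by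
        refine intervalIntegral.integral_congr_ae (Eventually.of_forall fun t ht => ?_)
        rw [uIoc_of_le hM'.le] at ht
        exact hFB t ht.1
      rw [this, intervalIntegral.integral_add (by simp) hBi]
      simp
      ring
    have hs : ∑ m ∈ Finset.range M, dilationSum f (m + 1) =
        M * (-(f 0) / 2) + ∑ m ∈ Finset.range M, B (m + 1) := by
      rw [Finset.sum_congr rfl fun (m : ℕ) _ => hFB ((m : ℝ) + 1) (by positivity), Finset.sum_add_distrib]
      simp
    rw [trapezoidError, sum_average_eq, hB0, hi, hs, hFB M hM']
    ring
  have := tendsto_nhds_unique hlim1 hlim2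
  rw [this]
  ring

end CosPair

/-! ### The integral of the dilation sum, by Mellin transform -/

namespace SmoothDecay

variable {α : ℝ} {f f₁ f₂ : ℝ → ℂ}

/-- The dilate by `k + 1` has Mellin transform `(k + 1)⁻ˢ` times that of `f`; absolute convergence
for `s > 1` allows termwise integration. -/
lemma mellin_dilationSum (hf : SmoothDecay α f f₁ f₂) {s : ℝ} (hs : 1 < s) (hsα : s < α) :
    mellin (dilationSum f) s = riemannZeta s * mellin f s := by
  have hα : 0 ≤ α := by linarith
  have hs0 : 0 < s := by linarith
  have hc : ∀ k : ℕ, MellinConvergent (fun t => f (((k : ℝ) + 1) * t)) (s : ℂ) := fun k =>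
    (MellinConvergent.comp_mul_left (by positivity)).2 (hf.mellinConvergent hα (by simpa) (by simpa))
  have hi := hf.integrableOn_rpow_mul_norm hα hs0 hsα
  have hnorm : ∀ k : ℕ, ∫ t in Ioi (0 : ℝ), ‖(t : ℂ) ^ ((s : ℂ) - 1) • f (((k : ℝ) + 1) * t)‖ =
      ((k : ℝ) + 1) ^ (-s) * ∫ t in Ioi (0 : ℝ), t ^ (s - 1) * ‖f t‖ := by
    intro k
    have hk : (0 : ℝ) < (k : ℝ) + 1 := by positivity
    have e := integral_comp_mul_left_Ioi (fun t => t ^ (s - 1) * ‖f t‖) 0 hk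
    rw [mul_zero, smul_eq_mul] at e
    rw [Real.rpow_neg hk.le, show s = 1 + (s - 1) by ring, Real.rpow_add hk, Real.rpow_one, mul_inv,
      mul_comm ((k : ℝ) + 1)⁻¹, mul_assoc, show 1 + (s - 1) - 1 = s - 1 by ring, ← e,
      ← integral_const_mul]
    refine setIntegral_congr_fun measurableSet_Ioi fun t ht => ?_
    have ht : 0 < t := ht
    have hsub : ((1 + (s - 1) : ℝ) : ℂ) - 1 = ((s - 1 : ℝ) : ℂ) := by push_cast; ring
    simp only [norm_smul, hsub, Complex.norm_cpow_eq_rpow_re_of_pos ht, Complex.ofReal_re]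
    rw [Real.mul_rpow hk.le ht.le, mul_assoc, inv_mul_cancel_left₀ (by positivity)]
  have hsum := hasSum_integral_of_summable_integral_norm hc
    (by simp only [hnorm]; exact (summable_nat_add_one_rpow_neg hs).mul_right _)
  have hz := zeta_eq_tsum_one_div_nat_add_one_cpow (s := s) (by simpa)
  have e1 : mellin (dilationSum f) s =
      ∫ t in Ioi (0 : ℝ), ∑' k : ℕ, (t : ℂ) ^ ((s : ℂ) - 1) • f (((k : ℝ) + 1) * t) := by
    rw [mellin]
    congr 1
    ext t
    rw [dilationSum, tsum_const_smul'']
    simp only [mul_comm]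
  rw [e1, ← hsum.tsum_eq, hz, ← tsum_mul_right]
  refine tsum_congr fun k => ?_
  have := mellin_comp_mul_left f s (by positivity : (0 : ℝ) < (k : ℝ) + 1)
  rw [mellin] at this
  rw [this, smul_eq_mul, Complex.cpow_neg, one_div]
  push_cast
  rfl

end SmoothDecay

namespace CosPair

variable {α : ℝ} {f H : ℝ → ℂ}

/-- Let `s → 1⁺` in `ζ(s) · mellin f s`. As `mellin f 1 = ∫ f = 0`, the limit is the residue `1`
times the derivative of `mellin f` at `1`, which inserts `log t`. The left side is continuous at `1`
because the dilation sum is bounded near `0`. -/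
lemma integral_dilationSum (h : CosPair α f H) (hα : 1 < α) :
    ∫ t in Ioi (0 : ℝ), dilationSum f t = ∫ t in Ioi (0 : ℝ), (Real.log t : ℂ) * f t := by
  obtain ⟨f₁, f₂, hf⟩ := h.left
  obtain ⟨-, hFi, ⟨D, hD⟩, -⟩ := h.tsum_dilationSum hα
  obtain ⟨C, hC0, hC⟩ := hf.exists_bound_dilationSum hα
  have hFl : LocallyIntegrableOn (dilationSum f) (Ioi 0) := hFi.locallyIntegrableOn
  have hFt : dilationSum f =O[atTop] fun t : ℝ => t ^ (-α) := by
    refine IsBigO.of_bound C ?_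
    filter_upwards [eventually_gt_atTop 0] with t ht
    rw [Real.norm_of_nonneg (by positivity)]
    exact hC t ht
  have hFb : dilationSum f =O[nhdsWithin 0 (Ioi 0)] fun t : ℝ => t ^ (-(0 : ℝ)) := by
    refine IsBigO.of_bound D ?_
    filter_upwards [Ioc_mem_nhdsGT (zero_lt_one (α := ℝ))] with t ht
    simpa using hD t ht.1 ht.2
  have hcont : ContinuousAt (mellin (dilationSum f)) 1 :=
    (mellin_differentiableAt_of_isBigO_rpow hFl hFt (by simpa) hFb (by simp)).continuousAt
  have hder : HasDerivAt (mellin f) (mellin (fun t => Real.log t • f t) 1) 1 :=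
    (mellin_hasDerivAt_of_isBigO_rpow hf.locallyIntegrableOn (hf.isBigO_atTop (by linarith))
      (by simpa) (hf.isBigO_zero (by linarith)) (by simp)).2
  have hm1 : mellin f 1 = 0 := by
    simp [mellin, h.integral_eq_zero hα]
  have hof : Tendsto (fun s : ℝ => (s : ℂ)) (nhdsWithin 1 (Ioi 1)) (nhdsWithin 1 {1}ᶜ) := by
    refine tendsto_nhdsWithin_iff.2 ⟨?_, ?_⟩
    · exact (Complex.continuous_ofReal.tendsto' 1 1 (by simp)).mono_left nhdsWithin_le_nhds
    · filter_upwards [self_mem_nhdsWithin] with s hs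
      simpa using (ne_of_gt (mem_Ioi.1 hs))
  have l1 := (hcont.tendsto.mono_left (nhdsWithin_le_nhds (s := {1}ᶜ))).comp hof
  have l2 := (riemannZeta_residue_one.comp hof).mul (hder.tendsto_slope.comp hof)
  -- The product is split as `(s - 1) ζ(s)` times the difference quotient of `mellin f` at `1`.
  have l3 := tendsto_nhds_unique (l1.congr' ?_) l2
  · simpa [mellin] using l3
  · filter_upwards [Ioo_mem_nhdsGT hα] with s hs
    have hne : (s : ℂ) - 1 ≠ 0 := by
      rw [sub_ne_zero]
      exact_mod_cast hs.1.ne'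
    simp only [Function.comp_apply, slope_def_field, hm1, sub_zero,
      hf.mellin_dilationSum hs.1 hs.2]
    field_simp

end CosPair

/-! ### Oscillatory integrals for `K₀` and `Y₀` -/

/-- Shifting the contour `[0, ∞)` by `iπ/2` in the integral of `exp(iXφ(s))`. -/
lemma oscillatory_integral_shift {X : ℝ} (hX : 0 < X) {φ : ℂ → ℂ} {p : ℝ → ℝ}
    (hφ : Differentiable ℂ φ) (hp : Continuous p) (hps : ∀ s, 0 ≤ s → s ≤ p s)
    (him : ∀ s θ : ℝ, (φ (s + θ * Complex.I)).im = p s * Real.sin θ)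
    (htop : ∀ s : ℝ, φ (s + (Real.pi / 2 : ℝ) * Complex.I) = p s * Complex.I) :
    (∀ R : ℝ, 0 ≤ R → ‖∫ s in (0 : ℝ)..R, Complex.exp (Complex.I * X * φ s)‖ ≤
      Real.pi + 1 / X) ∧
    Tendsto (fun R : ℝ => ∫ s in (0 : ℝ)..R, Complex.exp (Complex.I * X * φ s)) atTop
      (nhds (((∫ s in Ioi (0 : ℝ), Real.exp (-(X * p s)) : ℝ) : ℂ) +
        Complex.I * ∫ θ in (0 : ℝ)..(Real.pi / 2),
          Complex.exp (Complex.I * X * φ (θ * Complex.I)))) := by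
  set E : ℂ → ℂ := fun z => Complex.exp (Complex.I * X * φ z) with hE
  have hEd : Differentiable ℂ E := by fun_prop
  have hpi := Real.pi_pos
  have hnorm : ∀ s θ : ℝ, ‖E (s + θ * Complex.I)‖ = Real.exp (-(X * (p s * Real.sin θ))) := by
    intro s θ
    rw [hE, Complex.norm_exp, ← him s θ]
    congr 1
    simp [Complex.mul_re]
  have htop' : ∀ s : ℝ, E (s + (Real.pi / 2 : ℝ) * Complex.I) =
      (Real.exp (-(X * p s)) : ℂ) := by
    intro s
    simp only [hE, htop]
    rw [Complex.ofReal_exp]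
    congr 1
    push_cast
    linear_combination (X * p s : ℂ) * Complex.I_mul_I
  -- Cauchy's theorem on the rectangle with opposite corners `0` and `R + iπ/2`.
  have hrect : ∀ R : ℝ, ∫ s in (0 : ℝ)..R, E s =
      ((∫ s in (0 : ℝ)..R, Real.exp (-(X * p s)) : ℝ) : ℂ) +
        Complex.I * (∫ θ in (0 : ℝ)..(Real.pi / 2), E (θ * Complex.I)) -
        Complex.I * ∫ θ in (0 : ℝ)..(Real.pi / 2), E (R + θ * Complex.I) := by
    intro R
    have h := Complex.integral_boundary_rect_eq_zero_of_differentiableOn E 0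
      (R + (Real.pi / 2 : ℝ) * Complex.I) hEd.differentiableOn
    have r1 : ((R : ℂ) + (Real.pi / 2 : ℝ) * Complex.I).re = R := by simp
    have r2 : ((R : ℂ) + (Real.pi / 2 : ℝ) * Complex.I).im = Real.pi / 2 := by simp
    rw [r1, r2] at h
    simp only [Complex.zero_re, Complex.zero_im, htop', Complex.ofReal_zero, zero_mul, add_zero,
      zero_add, smul_eq_mul, intervalIntegral.integral_ofReal] at h
    linear_combination h
  have hexp : ∀ s, 0 ≤ s → Real.exp (-(X * p s)) ≤ Real.exp (-X * s) := fun s hs => by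
    rw [Real.exp_le_exp]
    nlinarith [hps s hs]
  have hexpi : IntegrableOn (fun s => Real.exp (-X * s)) (Ioi 0) := integrableOn_exp_mul_Ioi (by linarith) 0
  have hpi0 : IntegrableOn (fun s => Real.exp (-(X * p s))) (Ioi 0) := by
    refine Integrable.mono' hexpi (by fun_prop) ?_
    filter_upwards [ae_restrict_mem measurableSet_Ioi] with s hs
    rw [Real.norm_of_nonneg (Real.exp_pos _).le]
    exact hexp s (le_of_lt hs)
  have hside : ∀ R : ℝ, 0 ≤ R → ∀ θ ∈ Ioc (0 : ℝ) (Real.pi / 2), ‖E (R + θ * Complex.I)‖ ≤ 1 := by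
    intro R hR θ hθ
    rw [hnorm, Real.exp_le_one_iff, neg_nonpos]
    have := Real.sin_nonneg_of_nonneg_of_le_pi hθ.1.le (by linarith [hθ.2])
    have := hR.trans (hps R hR)
    positivity
  have hside' : ∀ R : ℝ, 0 ≤ R →
      ‖∫ θ in (0 : ℝ)..(Real.pi / 2), E (R + θ * Complex.I)‖ ≤ Real.pi / 2 := by
    intro R hR
    have := intervalIntegral.norm_integral_le_of_norm_le_const (a := 0) (b := Real.pi / 2)
      (f := fun θ : ℝ => E (R + θ * Complex.I)) (C := 1) fun θ hθ => by
        rw [uIoc_of_le (by positivity)] at hθ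
        exact hside R hR θ hθ
    simpa [abs_of_pos (by positivity : 0 < Real.pi / 2)] using this
  constructor
  · intro R hR
    rw [hrect R]
    have b1 : ‖((∫ s in (0 : ℝ)..R, Real.exp (-(X * p s)) : ℝ) : ℂ)‖ ≤ 1 / X := by
      rw [Complex.norm_real, Real.norm_of_nonneg
        (intervalIntegral.integral_nonneg hR fun s _ => (Real.exp_pos _).le),
        intervalIntegral.integral_of_le hR]
      calc _ ≤ ∫ s in Ioi (0 : ℝ), Real.exp (-(X * p s)) :=
            setIntegral_mono_set hpi0 (Eventually.of_forall fun s => (Real.exp_pos _).le)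
              Ioc_subset_Ioi_self.eventuallyLE
        _ ≤ ∫ s in Ioi (0 : ℝ), Real.exp (-X * s) :=
            setIntegral_mono_on hpi0 hexpi measurableSet_Ioi fun s hs => hexp s (le_of_lt hs)
        _ = 1 / X := by
            rw [integral_exp_mul_Ioi (by linarith)]
            simp
    have b2 := hside' 0 le_rfl
    have b3 := hside' R hR
    simp only [Complex.ofReal_zero, zero_add] at b2
    refine (norm_sub_le _ _).trans ?_
    refine (add_le_add_left (norm_add_le _ _) _).trans ?_
    rw [norm_mul, norm_mul, Complex.norm_I, one_mul, one_mul]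
    linarith
  · have l1 := (Complex.continuous_ofReal.tendsto _).comp
      (intervalIntegral_tendsto_integral_Ioi 0 hpi0 tendsto_id)
    -- The right side of the rectangle vanishes in the limit: its integrand is bounded by `1` and
    -- decays for each `θ > 0`, where `sin θ > 0`.
    have l2 : Tendsto (fun R : ℝ => ∫ θ in (0 : ℝ)..(Real.pi / 2), E (R + θ * Complex.I)) atTop
        (nhds (∫ θ in (0 : ℝ)..(Real.pi / 2), (0 : ℂ))) := by
      refine intervalIntegral.tendsto_integral_filter_of_dominated_convergence
        (bound := fun _ => 1) ?_ ?_ (by simp) ?_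
      · refine Eventually.of_forall fun R => ?_
        have : Continuous fun θ : ℝ => E (R + θ * Complex.I) := hEd.continuous.comp (by fun_prop)
        exact this.aestronglyMeasurable
      · filter_upwards [eventually_ge_atTop 0] with R hR
        refine Eventually.of_forall fun θ hθ => ?_
        rw [uIoc_of_le (by positivity)] at hθ
        exact hside R hR θ hθ
      · refine Eventually.of_forall fun θ hθ => ?_
        rw [uIoc_of_le (by positivity)] at hθ
        have hsin : 0 < Real.sin θ :=
          Real.sin_pos_of_pos_of_lt_pi hθ.1 (by linarith [hθ.2])
        rw [tendsto_zero_iff_norm_tendsto_zero]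
        simp only [hnorm]
        refine Real.tendsto_exp_neg_atTop_nhds_zero.comp ?_
        refine Tendsto.const_mul_atTop hX (Tendsto.atTop_mul_const hsin ?_)
        exact tendsto_atTop_mono' atTop ((eventually_ge_atTop 0).mono hps) tendsto_id
    simp only [intervalIntegral.integral_zero] at l2
    have l3 := (l1.add_const (Complex.I * ∫ θ in (0 : ℝ)..(Real.pi / 2), E (θ * Complex.I))).sub
      (l2.const_mul Complex.I)
    rw [mul_zero, sub_zero] at l3
    exact l3.congr fun R => (hrect R).symm

lemma intervalIntegral_cos_eq_re {X : ℝ} {φ : ℂ → ℂ} {ψ : ℝ → ℝ} (hφ : ∀ s : ℝ, φ s = ψ s)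
    (hψ : Continuous ψ) (R : ℝ) :
    ∫ s in (0 : ℝ)..R, Real.cos (X * ψ s) =
      (∫ s in (0 : ℝ)..R, Complex.exp (Complex.I * X * φ s)).re := by
  have e : ∀ s : ℝ, Complex.exp (Complex.I * X * φ s) =
      Complex.exp ((X * ψ s : ℝ) * Complex.I) := fun s => by
    rw [hφ]; congr 1; push_cast; ring
  simp only [e]
  have hi : IntervalIntegrable (fun s : ℝ => Complex.exp ((X * ψ s : ℝ) * Complex.I)) volume 0 R :=
    Continuous.intervalIntegrable (by fun_prop) _ _
  have := Complex.reCLM.intervalIntegral_comp_comm hi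
  simp only [Complex.reCLM_apply, Complex.exp_ofReal_mul_I_re] at this
  exact this

/-- On the top side `sinh(s + iπ/2) = i cosh s`, which produces `K₀`. The left side of the rectangle
contributes `i` times a real number and drops out of the real part. -/
lemma cos_sinh_integral {X : ℝ} (hX : 0 < X) :
    (∀ R : ℝ, 0 ≤ R → |∫ s in (0 : ℝ)..R, Real.cos (X * Real.sinh s)| ≤ Real.pi + 1 / X) ∧
    Tendsto (fun R : ℝ => ∫ s in (0 : ℝ)..R, Real.cos (X * Real.sinh s)) atTop
      (nhds (besselK0 X)) := by
  obtain ⟨hb, hl⟩ := oscillatory_integral_shift hX (φ := Complex.sinh) (p := Real.cosh)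
    Complex.differentiable_sinh Real.continuous_cosh
    (fun s hs => (Real.self_le_sinh_iff.2 hs).trans (Real.sinh_lt_cosh s).le)
    (fun s θ => by
      rw [Complex.sinh_add, Complex.cosh_mul_I, Complex.sinh_mul_I, ← Complex.ofReal_sin,
        ← Complex.ofReal_cos, ← Complex.ofReal_sinh, ← Complex.ofReal_cosh]
      simp [-Complex.ofReal_sin, -Complex.ofReal_cos, -Complex.ofReal_sinh, -Complex.ofReal_cosh])
    (fun s => by
      rw [Complex.sinh_add, Complex.cosh_mul_I, Complex.sinh_mul_I, ← Complex.ofReal_sin,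
        ← Complex.ofReal_cos, Real.sin_pi_div_two, Real.cos_pi_div_two]
      simp)
  have e := fun R => intervalIntegral_cos_eq_re (X := X) (φ := Complex.sinh)
    (fun s => (Complex.ofReal_sinh s).symm) Real.continuous_sinh R
  have hside : ∀ θ : ℝ, Complex.exp (Complex.I * X * Complex.sinh (θ * Complex.I)) =
      (Real.exp (-(X * Real.sin θ)) : ℂ) := by
    intro θ
    rw [Complex.sinh_mul_I, Complex.ofReal_exp]
    congr 1
    push_cast
    linear_combination (X * Complex.sin θ : ℂ) * Complex.I_mul_I
  simp only [hside, intervalIntegral.integral_ofReal] at hl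
  refine ⟨fun R hR => (e R) ▸ (Complex.abs_re_le_norm _).trans (hb R hR), ?_⟩
  have := (Complex.continuous_re.tendsto _).comp hl
  simp only [Complex.add_re, Complex.ofReal_re, Complex.mul_re, Complex.I_re, Complex.I_im,
    Complex.ofReal_im, zero_mul, mul_zero, sub_zero, add_zero] at this
  exact this.congr fun R => (e R).symm

lemma integral_sin_mul_sin (X : ℝ) :
    ∫ θ in (0 : ℝ)..Real.pi, Real.sin (X * Real.sin θ) =
      2 * ∫ θ in (0 : ℝ)..(Real.pi / 2), Real.sin (X * Real.cos θ) := by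
  set g : ℝ → ℝ := fun θ => Real.sin (X * Real.cos θ) with hg
  have hi : ∀ a b, IntervalIntegrable g volume a b := fun a b =>
    Continuous.intervalIntegrable (by fun_prop) a b
  have h1 := intervalIntegral.integral_comp_sub_left (a := 0) (b := Real.pi) g (Real.pi / 2)
  have h2 := intervalIntegral.integral_comp_neg (a := 0) (b := Real.pi / 2) g
  simp only [hg, Real.cos_pi_div_two_sub] at h1
  simp only [hg, Real.cos_neg, neg_zero] at h2
  rw [h1, show Real.pi / 2 - Real.pi = -(Real.pi / 2) by ring, sub_zero,
    ← intervalIntegral.integral_add_adjacent_intervals (hi (-(Real.pi / 2)) 0) (hi 0 _), ← h2]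
  ring

/-- Here `cosh(s + iπ/2) = i sinh s` on the top side gives the exponential part of Schläfli's
integral, and the real part of the left side gives its sine part. -/
lemma cos_cosh_integral {X : ℝ} (hX : 0 < X) :
    (∀ R : ℝ, 0 ≤ R → |∫ s in (0 : ℝ)..R, Real.cos (X * Real.cosh s)| ≤ Real.pi + 1 / X) ∧
    Tendsto (fun R : ℝ => ∫ s in (0 : ℝ)..R, Real.cos (X * Real.cosh s)) atTop
      (nhds (-(Real.pi / 2) * besselY0 X)) := by
  obtain ⟨hb, hl⟩ := oscillatory_integral_shift hX (φ := Complex.cosh) (p := Real.sinh)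
    Complex.differentiable_cosh Real.continuous_sinh
    (fun s hs => Real.self_le_sinh_iff.2 hs)
    (fun s θ => by
      rw [Complex.cosh_add, Complex.cosh_mul_I, Complex.sinh_mul_I, ← Complex.ofReal_sin,
        ← Complex.ofReal_cos, ← Complex.ofReal_sinh, ← Complex.ofReal_cosh]
      simp [-Complex.ofReal_sin, -Complex.ofReal_cos, -Complex.ofReal_sinh, -Complex.ofReal_cosh])
    (fun s => by
      rw [Complex.cosh_add, Complex.cosh_mul_I, Complex.sinh_mul_I, ← Complex.ofReal_sin,
        ← Complex.ofReal_cos, Real.sin_pi_div_two, Real.cos_pi_div_two]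
      simp)
  have e := fun R => intervalIntegral_cos_eq_re (X := X) (φ := Complex.cosh)
    (fun s => (Complex.ofReal_cosh s).symm) Real.continuous_cosh R
  refine ⟨fun R hR => (e R) ▸ (Complex.abs_re_le_norm _).trans (hb R hR), ?_⟩
  have := (Complex.continuous_re.tendsto _).comp hl
  have hside : ∀ θ : ℝ, Complex.exp (Complex.I * X * Complex.cosh (θ * Complex.I)) =
      Complex.exp ((X * Real.cos θ : ℝ) * Complex.I) := by
    intro θ
    rw [Complex.cosh_mul_I]
    congr 1
    push_cast
    ring
  simp only [hside] at this
  have hi : IntervalIntegrable (fun θ : ℝ => Complex.exp ((X * Real.cos θ : ℝ) * Complex.I))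
      volume 0 (Real.pi / 2) := Continuous.intervalIntegrable (by fun_prop) _ _
  have him := Complex.imCLM.intervalIntegral_comp_comm hi
  simp only [Complex.imCLM_apply, Complex.exp_ofReal_mul_I_im] at him
  rw [Complex.add_re, Complex.ofReal_re, Complex.mul_re, Complex.I_re, Complex.I_im, zero_mul,
    one_mul, zero_sub, ← him] at this
  refine (this.congr fun R => (e R).symm).trans (le_of_eq ?_)
  congr 1
  rw [besselY0, integral_sin_mul_sin]
  have := Real.pi_ne_zero
  field_simp
  ring

/-! ### The kernel as a limit of truncated integrals -/

/-- The sum of the two oscillating integrands that represent `K_0` and `Y_0`, integrated. -/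
noncomputable def oscillatoryPrimitive (X R : ℝ) : ℝ :=
  ∫ s in (0 : ℝ)..R, (Real.cos (X * Real.cosh s) + Real.cos (X * Real.sinh s))

lemma oscillatoryPrimitive_neg (X R : ℝ) :
    oscillatoryPrimitive X (-R) = -oscillatoryPrimitive X R := by
  have h := intervalIntegral.integral_comp_neg (a := 0) (b := R)
    (fun s => Real.cos (X * Real.cosh s) + Real.cos (X * Real.sinh s))
  simp only [Real.cosh_neg, Real.sinh_neg, mul_neg, Real.cos_neg, neg_zero] at h
  rw [oscillatoryPrimitive, oscillatoryPrimitive, h, intervalIntegral.integral_symm]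

lemma oscillatoryPrimitive_eq_add (X R : ℝ) : oscillatoryPrimitive X R =
    (∫ s in (0 : ℝ)..R, Real.cos (X * Real.cosh s)) + ∫ s in (0 : ℝ)..R, Real.cos (X * Real.sinh s) :=
  intervalIntegral.integral_add (Continuous.intervalIntegrable (by fun_prop) _ _)
    (Continuous.intervalIntegrable (by fun_prop) _ _)

lemma abs_oscillatoryPrimitive_le {X : ℝ} (hX : 0 < X) (R : ℝ) :
    |oscillatoryPrimitive X R| ≤ 2 * (Real.pi + 1 / X) := by
  wlog hR : 0 ≤ R generalizing R
  · have := this (-R) (by linarith)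
    rwa [oscillatoryPrimitive_neg, abs_neg] at this
  rw [oscillatoryPrimitive_eq_add]
  have h1 := (cos_cosh_integral hX).1 R hR
  have h2 := (cos_sinh_integral hX).1 R hR
  exact (abs_add_le _ _).trans (by linarith)

lemma tendsto_oscillatoryPrimitive {X : ℝ} (hX : 0 < X) :
    Tendsto (oscillatoryPrimitive X) atTop
      (nhds (-(Real.pi / 2) * besselY0 X + besselK0 X)) :=
  ((cos_cosh_integral hX).2.add (cos_sinh_integral hX).2).congr fun R =>
    (oscillatoryPrimitive_eq_add X R).symm

/-- A truncation of the kernel `4 K_0(4π√(ξy)) - 2π Y_0(4π√(ξy))`. -/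
noncomputable def truncatedKernel (n ξ y : ℝ) : ℝ :=
  ∫ s in (-n)..n, 4 * (Real.cos (2 * Real.pi * ξ * Real.exp s) *
    Real.cos (2 * Real.pi * Real.exp (-s) * y))

/-- Shifting `s` by `c = log √(y/ξ)` balances the frequencies, `ξ eᶜ = y e⁻ᶜ = √(ξy)`. The product
of cosines then splits into `cos(X cosh s)` and `cos(X sinh s)`, and oddness of the primitive
handles the lower endpoint. -/
lemma truncatedKernel_eq {ξ y : ℝ} (hξ : 0 < ξ) (hy : 0 < y) (n : ℝ) :
    truncatedKernel n ξ y =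
      2 * (oscillatoryPrimitive (4 * Real.pi * √(ξ * y)) (n - Real.log (√(y / ξ))) +
        oscillatoryPrimitive (4 * Real.pi * √(ξ * y)) (n + Real.log (√(y / ξ)))) := by
  set c := Real.log (√(y / ξ)) with hc
  set X := 4 * Real.pi * √(ξ * y) with hX
  have hec : Real.exp c = √(y / ξ) := Real.exp_log (by positivity)
  have e1 : ξ * Real.exp c = √(ξ * y) := by
    rw [hec, eq_comm, Real.sqrt_eq_iff_mul_self_eq (by positivity) (by positivity)]
    rw [mul_mul_mul_comm, Real.mul_self_sqrt (by positivity)]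
    field_simp
  have e2 : y * Real.exp (-c) = √(ξ * y) := by
    rw [Real.exp_neg, ← e1, hec, ← div_eq_mul_inv, div_eq_iff (by positivity), mul_assoc,
      Real.mul_self_sqrt (by positivity)]
    field_simp
  set q : ℝ → ℝ := fun s => Real.cos (X * Real.cosh s) + Real.cos (X * Real.sinh s) with hq
  have hqc : Continuous q := by fun_prop
  have hpt : ∀ s, 4 * (Real.cos (2 * Real.pi * ξ * Real.exp (s + c)) *
      Real.cos (2 * Real.pi * Real.exp (-(s + c)) * y)) = 2 * q s := by
    intro s
    have a1 : 2 * Real.pi * ξ * Real.exp (s + c) = X / 2 * Real.exp s := by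
      rw [Real.exp_add, hX, ← e1]; ring
    have a2 : 2 * Real.pi * Real.exp (-(s + c)) * y = X / 2 * Real.exp (-s) := by
      rw [neg_add, Real.exp_add, hX, ← e2]; ring
    rw [a1, a2]
    simp only [hq, Real.cosh_eq, Real.sinh_eq]
    have b1 : X * ((Real.exp s + Real.exp (-s)) / 2) =
      X / 2 * Real.exp s + X / 2 * Real.exp (-s) := by ring
    have b2 : X * ((Real.exp s - Real.exp (-s)) / 2) =
      X / 2 * Real.exp s - X / 2 * Real.exp (-s) := by ring
    simp only [b1, b2, Real.cos_add, Real.cos_sub]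
    ring
  have hshift := intervalIntegral.integral_comp_add_right (a := -n - c) (b := n - c)
    (fun s => 4 * (Real.cos (2 * Real.pi * ξ * Real.exp s) *
      Real.cos (2 * Real.pi * Real.exp (-s) * y))) c
  rw [sub_add_cancel, sub_add_cancel] at hshift
  rw [truncatedKernel, ← hshift]
  simp only [hpt]
  rw [intervalIntegral.integral_const_mul]
  congr 1
  have hneg := oscillatoryPrimitive_neg X (n + c)
  rw [← intervalIntegral.integral_interval_sub_left
    (a := 0) (hqc.intervalIntegrable _ _) (hqc.intervalIntegrable _ _)]
  change oscillatoryPrimitive X (n - c) - oscillatoryPrimitive X (-n - c) = _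
  rw [show -n - c = -(n + c) by ring, hneg]
  ring

/-- The bound is uniform in `n`, and its `y^(-1/2)` singularity is integrable against `f`; it is the
dominating function for the limit `n → ∞`. -/
lemma abs_truncatedKernel_le {ξ y : ℝ} (hξ : 0 < ξ) (hy : 0 < y) (n : ℝ) :
    |truncatedKernel n ξ y| ≤ 8 * (Real.pi + 1 / (4 * Real.pi * √(ξ * y))) := by
  have hX : 0 < 4 * Real.pi * √(ξ * y) := by positivity
  rw [truncatedKernel_eq hξ hy, abs_mul, abs_two]
  have h1 := abs_oscillatoryPrimitive_le hX (n - Real.log (√(y / ξ)))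
  have h2 := abs_oscillatoryPrimitive_le hX (n + Real.log (√(y / ξ)))
  have h3 := abs_add_le (oscillatoryPrimitive (4 * Real.pi * √(ξ * y)) (n - Real.log (√(y / ξ))))
    (oscillatoryPrimitive (4 * Real.pi * √(ξ * y)) (n + Real.log (√(y / ξ))))
  linarith

lemma tendsto_truncatedKernel {ξ y : ℝ} (hξ : 0 < ξ) (hy : 0 < y) :
    Tendsto (fun n : ℕ => truncatedKernel n ξ y) atTop (nhds (voronoiKernel (ξ * y))) := by
  have hX : 0 < 4 * Real.pi * √(ξ * y) := by positivity
  have h := tendsto_oscillatoryPrimitive hX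
  have hn := tendsto_natCast_atTop_atTop (R := ℝ)
  have h1 := h.comp (tendsto_atTop_add_const_right atTop (-Real.log (√(y / ξ))) hn)
  have h2 := h.comp (tendsto_atTop_add_const_right atTop (Real.log (√(y / ξ))) hn)
  refine (((h1.add h2).const_mul 2).congr fun n => ?_).trans (le_of_eq ?_)
  · rw [truncatedKernel_eq hξ hy, sub_eq_add_neg]
    rfl
  · rw [voronoiKernel]
    congr 1
    ring

lemma continuous_truncatedKernel (n ξ : ℝ) : Continuous (truncatedKernel n ξ) := by
  unfold truncatedKernel
  apply intervalIntegral.continuous_parametric_intervalIntegral_of_continuous'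
  fun_prop

namespace SmoothDecay

variable {α : ℝ} {f f₁ f₂ : ℝ → ℂ}

lemma integrableOn_kernel_bound (hf : SmoothDecay α f f₁ f₂) (hα : 1 < α) {ξ : ℝ} (hξ : 0 < ξ) :
    IntegrableOn (fun y => 8 * (Real.pi + 1 / (4 * Real.pi * √(ξ * y))) * ‖f y‖) (Ioi 0) := by
  have h1 := ((hf.integrableOn hα).norm).const_mul (8 * Real.pi)
  have h2 := (hf.integrableOn_rpow_mul_norm (by linarith) (s := 1 / 2) (by norm_num)
    (by linarith)).const_mul (8 * (1 / (4 * Real.pi * √ξ)))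
  refine (integrableOn_congr_fun (fun y hy => ?_) measurableSet_Ioi).1 (h1.add h2)
  have hy : 0 < y := hy
  rw [Pi.add_apply, Real.sqrt_mul hξ.le, show (1 / 2 - 1 : ℝ) = -(1 / 2) by norm_num,
    Real.rpow_neg hy.le, ← Real.sqrt_eq_rpow]
  field_simp

lemma norm_truncatedKernel_mul_le {ξ : ℝ} (hξ : 0 < ξ) (n : ℝ) :
    ∀ᵐ y ∂volume.restrict (Ioi (0 : ℝ)), ‖(truncatedKernel n ξ y : ℂ) * f y‖ ≤
      8 * (Real.pi + 1 / (4 * Real.pi * √(ξ * y))) * ‖f y‖ := by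
  filter_upwards [ae_restrict_mem measurableSet_Ioi] with y hy
  rw [norm_mul, Complex.norm_real]
  exact mul_le_mul_of_nonneg_right (abs_truncatedKernel_le hξ hy n) (norm_nonneg _)

lemma aestronglyMeasurable_truncatedKernel_mul (hf : SmoothDecay α f f₁ f₂) (n ξ : ℝ) :
    AEStronglyMeasurable (fun y => (truncatedKernel n ξ y : ℂ) * f y)
      (volume.restrict (Ioi 0)) := by
  have := continuous_truncatedKernel n ξ
  exact (by fun_prop : Continuous fun y => (truncatedKernel n ξ y : ℂ)).aestronglyMeasurable.mul
    ((hf.continuousOn.mono Ioi_subset_Ici_self).aestronglyMeasurable measurableSet_Ioi)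

lemma tendsto_truncatedKernel_mul {ξ : ℝ} (hξ : 0 < ξ) :
    ∀ᵐ y ∂volume.restrict (Ioi (0 : ℝ)), Tendsto (fun n : ℕ => (truncatedKernel n ξ y : ℂ) * f y)
      atTop (nhds ((voronoiKernel (ξ * y) : ℂ) * f y)) := by
  filter_upwards [ae_restrict_mem measurableSet_Ioi] with y hy
  exact ((Complex.continuous_ofReal.tendsto _).comp (tendsto_truncatedKernel hξ hy)).mul_const _

lemma integrableOn_voronoiKernel_mul (hf : SmoothDecay α f f₁ f₂) (hα : 1 < α) {ξ : ℝ}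
    (hξ : 0 < ξ) : IntegrableOn (fun y => (voronoiKernel (ξ * y) : ℂ) * f y) (Ioi 0) := by
  refine Integrable.mono' (hf.integrableOn_kernel_bound hα hξ)
    (aestronglyMeasurable_of_tendsto_ae atTop
      (fun n : ℕ => hf.aestronglyMeasurable_truncatedKernel_mul n ξ)
      (tendsto_truncatedKernel_mul hξ)) ?_
  filter_upwards [tendsto_truncatedKernel_mul (f := f) hξ,
    ae_all_iff.2 fun n : ℕ => norm_truncatedKernel_mul_le (f := f) hξ n] with y h1 h2
  exact le_of_tendsto h1.norm (Eventually.of_forall h2)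

/-- Truncation makes Fubini legitimate: on a bounded `s`-interval the integrand is at most `4 |f
y|`, whereas over all `s` the kernel integral converges only conditionally. -/
lemma integral_truncatedKernel_mul (hf : SmoothDecay α f f₁ f₂) (hα : 1 < α) (n ξ : ℝ) :
    ∫ y in Ioi (0 : ℝ), (truncatedKernel n ξ y : ℂ) * f y =
      ∫ s in (-n)..n, 2 * (Real.cos (2 * Real.pi * ξ * Real.exp s) : ℂ) *
        cosTransform f (Real.exp (-s)) := by
  set k : ℝ → ℝ → ℝ := fun s y => 4 * (Real.cos (2 * Real.pi * ξ * Real.exp s) *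
    Real.cos (2 * Real.pi * Real.exp (-s) * y)) with hk
  have hkb : ∀ s y, |k s y| ≤ 4 := by
    intro s y
    rw [hk]
    simp only [abs_mul]
    rw [abs_of_pos (by norm_num : (0 : ℝ) < 4)]
    have h1 := Real.abs_cos_le_one (2 * Real.pi * ξ * Real.exp s)
    have h2 := Real.abs_cos_le_one (2 * Real.pi * Real.exp (-s) * y)
    have := mul_le_one₀ h1 (abs_nonneg _) h2
    linarith
  have hint : Integrable (Function.uncurry fun s y => (k s y : ℂ) * f y)
      ((volume.restrict (uIoc (-n) n)).prod (volume.restrict (Ioi 0))) := by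
    have h1 : Integrable (fun p : ℝ × ℝ => (1 : ℂ) * f p.2)
        ((volume.restrict (uIoc (-n) n)).prod (volume.restrict (Ioi 0))) :=
      Integrable.mul_prod (f := fun _ : ℝ => (1 : ℂ)) 
        (intervalIntegrable_iff.1 (intervalIntegrable_const)) (hf.integrableOn hα)
    simp only [one_mul] at h1
    refine h1.bdd_mul (c := 4) ?_ ?_
    · exact (by fun_prop : Continuous fun p : ℝ × ℝ => ((k p.1 p.2 : ℝ) : ℂ)).aestronglyMeasurable
    · refine Eventually.of_forall fun p => ?_
      rw [Complex.norm_real]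
      exact hkb _ _
  have hswap := intervalIntegral_integral_swap hint
  have e1 : ∀ y, ∫ s in (-n)..n, (k s y : ℂ) * f y = (truncatedKernel n ξ y : ℂ) * f y := by
    intro y
    rw [intervalIntegral.integral_mul_const, intervalIntegral.integral_ofReal]
    rfl
  simp only [e1] at hswap
  rw [← hswap]
  refine intervalIntegral.integral_congr fun s _ => ?_
  simp only [cosTransform, hk]
  rw [← mul_assoc, ← integral_const_mul]
  refine integral_congr_ae (Eventually.of_forall fun y => ?_)
  push_cast
  ring

end SmoothDecay

namespace CosPair

variable {α : ℝ} {f H : ℝ → ℂ}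

/-- The transform with the kernel `4 K_0(4π√z) - 2π Y_0(4π√z)` factors through the cosine transform
in two steps. -/
lemma voronoiTransform_eq (h : CosPair α f H) (hα : 1 < α) {ξ : ℝ} (hξ : 0 < ξ) :
    voronoiTransform f ξ = cosTransform H ξ := by
  obtain ⟨f₁, f₂, hf⟩ := h.left
  obtain ⟨H₁, H₂, hH⟩ := h.right
  have l1 : Tendsto (fun n : ℕ => ∫ y in Ioi (0 : ℝ), (truncatedKernel n ξ y : ℂ) * f y) atTop
      (nhds (voronoiTransform f ξ)) :=
    tendsto_integral_of_dominated_convergence _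
      (fun n => hf.aestronglyMeasurable_truncatedKernel_mul n ξ)
      (hf.integrableOn_kernel_bound hα hξ)
      (fun n => SmoothDecay.norm_truncatedKernel_mul_le hξ n)
      (SmoothDecay.tendsto_truncatedKernel_mul hξ)
  set g : ℝ → ℂ := fun v => H v * (Real.cos (2 * Real.pi * ξ * v) : ℂ) with hg
  have hgi : IntegrableOn g (Ioi 0) := hH.integrableOn_mul_cos hα _
  have hgc : ContinuousOn g (Ici 0) := hH.continuousOn.mul (by fun_prop)
  -- The substitution `v = eˢ` carries `[-n, n]` to intervals exhausting `(0, ∞)`.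
  have hcov : AECover (volume.restrict (Ioi (0 : ℝ))) atTop
      fun n : ℕ => Ioi (Real.exp (-(n : ℝ))) ∩ Iic (Real.exp n) := by
    have hn := tendsto_natCast_atTop_atTop (R := ℝ)
    exact (aecover_Ioi_of_Ioi (Real.tendsto_exp_neg_atTop_nhds_zero.comp hn)).inter
      (aecover_Iic (Real.tendsto_exp_atTop.comp hn))
  have l2 := (hcov.integral_tendsto_of_countably_generated hgi).const_mul 2
  refine tendsto_nhds_unique l1 (l2.congr fun n => ?_)
  have hle : Real.exp (-(n : ℝ)) ≤ Real.exp n := Real.exp_le_exp.2 (by linarith [n.cast_nonneg (α := ℝ)])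
  have hsub : Ioc (Real.exp (-(n : ℝ))) (Real.exp n) ⊆ Ioi 0 := fun v hv =>
    (Real.exp_pos _).trans hv.1
  have hcv := intervalIntegral.integral_deriv_smul_comp' (a := -(n : ℝ)) (b := n) (f := Real.exp)
    (f' := Real.exp) (g := g) (fun s _ => Real.hasDerivAt_exp s) (by fun_prop)
    (hgc.mono (by rintro _ ⟨s, -, rfl⟩; exact (Real.exp_pos s).le))
  rw [hf.integral_truncatedKernel_mul hα, Ioi_inter_Iic,
    Measure.restrict_restrict measurableSet_Ioc, inter_eq_left.2 hsub,
    ← intervalIntegral.integral_of_le hle, ← hcv, ← intervalIntegral.integral_const_mul]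
  refine intervalIntegral.integral_congr fun s _ => ?_
  -- `f̂(e⁻ˢ) = eˢ H(eˢ)`, and the factor `eˢ` is the Jacobian of the substitution.
  have hE := h.cosTransform_eq (Real.exp_pos (-s))
  rw [← Real.exp_neg, neg_neg] at hE
  simp only [hE, hg, Function.comp_apply, Complex.real_smul]
  ring

end CosPair

/-! ### Divisor sums and assembly of the formula -/

/-- A Dirichlet divisor sum is a double sum. -/
lemma divisor_sum_eq_double_sum {g : ℕ → ℂ} {β C : ℝ} (hβ : 1 < β)
    (hg : ∀ n : ℕ, 0 < n → ‖g n‖ ≤ C * (n : ℝ) ^ (-β)) :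
    (Summable fun n : ℕ => (n.divisors.card : ℂ) * g n) ∧
    ∑' n : ℕ, (n.divisors.card : ℂ) * g n = ∑' k : ℕ, ∑' m : ℕ, g ((k + 1) * (m + 1)) := by
  have hs := summable_nat_add_one_rpow_neg hβ
  have hN : Summable fun p : ℕ × ℕ => g ((p.1 + 1) * (p.2 + 1)) := by
    refine Summable.of_norm_bounded ((hs.mul_of_nonneg hs (fun k => ?_) fun k => ?_).mul_left C)
      fun p => (hg _ (by positivity)).trans (le_of_eq ?_)
    · positivity
    · positivity
    · push_cast
      rw [Real.mul_rpow (by positivity) (by positivity)]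
  set e := Equiv.prodCongr Equiv.pnatEquivNat Equiv.pnatEquivNat
  have hcomp : (fun p : ℕ × ℕ => g ((p.1 + 1) * (p.2 + 1))) ∘ e =
      fun p : ℕ+ × ℕ+ => g (p.1 * p.2) := by
    ext p
    simp [e, Equiv.pnatEquivNat, PNat.natPred_add_one]
  have hcomp' : (fun p : ℕ+ × ℕ+ => g (p.1 * p.2)) ∘ sigmaAntidiagonalEquivProd =
      fun c : (n : ℕ+) × Nat.divisorsAntidiagonal n => g c.1 := by
    ext c
    exact congrArg g (divisorsAntidiagonalFactors_eq c.2)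
  have hP : Summable fun p : ℕ+ × ℕ+ => g (p.1 * p.2) := hcomp ▸ e.summable_iff.2 hN
  have hS : Summable fun c : (n : ℕ+) × Nat.divisorsAntidiagonal n => g c.1 :=
    hcomp' ▸ sigmaAntidiagonalEquivProd.summable_iff.2 hP
  -- The fibre over `n` is the set of pairs with product `n`, which the first factor matches with
  -- the divisors of `n`.
  have hfib : ∀ n : ℕ+, ∑' _ : Nat.divisorsAntidiagonal n, g n =
      ((n : ℕ).divisors.card : ℂ) * g n := by
    intro n
    rw [tsum_fintype, Finset.sum_const, Finset.card_univ, Fintype.card_coe, nsmul_eq_mul,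
      ← Nat.map_div_right_divisors, Finset.card_map]
  have h1 := hS.sigma
  have h2 := hS.tsum_sigma
  simp only [hfib] at h1 h2
  refine ⟨(summable_pnat_iff_summable_nat (f := fun n : ℕ => (n.divisors.card : ℂ) * g n)).1 h1, ?_⟩
  rw [← tsum_pnat_eq_tsum_of_eq_zero (f := fun n : ℕ => (n.divisors.card : ℂ) * g n) (by simp),
    ← h2, ← hN.tsum_prod, ← e.tsum_eq, ← sigmaAntidiagonalEquivProd.tsum_eq]
  · refine tsum_congr fun c => ?_
    have a1 := congrFun hcomp' c
    have a2 := congrFun hcomp (sigmaAntidiagonalEquivProd c)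
    simp only [Function.comp_apply] at a1 a2
    exact (a2.trans a1).symm

/-- The constants convert between the normalisations: `f̂(u)` is `2/√(2/π)` times `fourierCos f
(2πu)`, and `h(v/(2π))` carries the factor `2π/v`. -/
lemma MuntzClass.cosPair {α : ℝ} (hα : 0 ≤ α) {f h : ℝ → ℂ} (hf : MuntzClass α f)
    (hh : MuntzClass α h) (hfh : ∀ x : ℝ, 0 < x → h x = ((x⁻¹ : ℝ) : ℂ) * fourierCos f x⁻¹) :
    CosPair α f fun v => (((Real.pi * √(2 / Real.pi))⁻¹ : ℝ) : ℂ) * h ((2 * Real.pi)⁻¹ * v) := by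
  obtain ⟨h₁, h₂, hd⟩ := hh.smoothDecay hα
  have hpi := Real.pi_pos
  refine ⟨hf.smoothDecay hα, ⟨_, _, hd.comp_mul hα _ (by positivity)⟩, fun v hv => ?_⟩
  have hs : (√(2 / Real.pi) : ℂ) ≠ 0 := by
    exact_mod_cast (Real.sqrt_pos.2 (by positivity)).ne'
  have hpc : (Real.pi : ℂ) ≠ 0 := by exact_mod_cast hpi.ne'
  have hvc : (v : ℂ) ≠ 0 := by exact_mod_cast hv.ne'
  have he : ((2 * Real.pi)⁻¹ * v)⁻¹ = 2 * Real.pi * v⁻¹ := by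
    rw [mul_inv, inv_inv]
  rw [hfh _ (by positivity), fourierCos, cosTransform, he]
  push_cast
  field_simp

lemma CosPair.integrableOn_log {α : ℝ} {f H : ℝ → ℂ} (h : CosPair α f H) (hα : 1 < α) :
    IntegrableOn (fun t => (Real.log t : ℂ) * f t) (Ioi 0) := by
  obtain ⟨f₁, f₂, hf⟩ := h.left
  have := (mellin_hasDerivAt_of_isBigO_rpow (s := 1) hf.locallyIntegrableOn
    (hf.isBigO_atTop (by linarith)) (by simpa) (hf.isBigO_zero (by linarith)) (by simp)).1
  simpa [MellinConvergent] using this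

theorem theorem3 (α : ℝ) (hα : 2 < α) (f : ℝ → ℂ) (hf : MuntzClass α f)
    (hFf : ∃ h : ℝ → ℂ, MuntzClass α h ∧
      ∀ x : ℝ, 0 < x → h x = ((x⁻¹ : ℝ) : ℂ) * fourierCos f x⁻¹) :
    (∀ ξ : ℝ, 0 < ξ → IntegrableOn (fun y : ℝ => (voronoiKernel (ξ * y) : ℂ) * f y) (Ioi 0)) ∧
    ∀ x : ℝ, 0 < x →
      (Summable fun n : ℕ => (n.divisors.card : ℂ) * f (n * x)) ∧
      IntegrableOn (fun y : ℝ =>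
        f (x * y) * ((Real.log y + 2 * Real.eulerMascheroniConstant : ℝ) : ℂ)) (Ioi 0) ∧
      (Summable fun n : ℕ => (n.divisors.card : ℂ) * voronoiTransform f (n / x)) ∧
      voronoiOperator f x =
        f 0 / 4 + ((x⁻¹ : ℝ) : ℂ) *
          ∑' n : ℕ, (n.divisors.card : ℂ) * voronoiTransform f (n / x) := by
  have hα1 : 1 < α := by linarith
  have hα0 : 0 ≤ α := by linarith
  obtain ⟨h, hh, hfh⟩ := hFf
  have hpair := hf.cosPair hα0 hh hfh
  obtain ⟨f₁, f₂, hfd⟩ := hpair.left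
  set H : ℝ → ℂ := fun v =>
    (((Real.pi * √(2 / Real.pi))⁻¹ : ℝ) : ℂ) * h ((2 * Real.pi)⁻¹ * v)
  refine ⟨fun ξ hξ => hfd.integrableOn_voronoiKernel_mul hα1 hξ, fun x hx => ?_⟩
  have hx' : (x : ℂ) ≠ 0 := by exact_mod_cast hx.ne'
  -- Dilating `f` and `H` by `x` preserves the pair, so it suffices to use the formula at `x = 1`
  -- for the dilates.
  have hpx := hpair.comp_mul hα0 hx
  obtain ⟨g₁, g₂, hg⟩ := hpx.left
  obtain ⟨K₁, K₂, hK⟩ := hpx.right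
  obtain ⟨-, -, -, hmain⟩ := hpx.tsum_dilationSum hα1
  obtain ⟨C, -, -, hC⟩ := hg.exists_bound_rpow hα0
  obtain ⟨D, -, hD⟩ := hK.cosTransform_bound hα1
  obtain ⟨hs1, ht1⟩ := divisor_sum_eq_double_sum (g := fun n : ℕ => f (x * n)) hα1
    fun n hn => hC n (by exact_mod_cast hn)
  obtain ⟨hs2, ht2⟩ := divisor_sum_eq_double_sum
    (g := fun n : ℕ => cosTransform (fun t => H (x * t)) n) (C := D) one_lt_two fun n hn => by
      have hn' : (0 : ℝ) < n := by exact_mod_cast hn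
      refine (hD n hn').trans (le_of_eq ?_)
      rw [Real.rpow_neg hn'.le, div_eq_mul_inv]
      norm_cast
  -- The term `n = 0`, where the kernel identity is not available, vanishes on both sides as `0` has
  -- no divisors in `Nat.divisors`.
  have hV : ∀ n : ℕ, (n.divisors.card : ℂ) * voronoiTransform f (n / x) =
      x * ((n.divisors.card : ℂ) * cosTransform (fun t => H (x * t)) n) := by
    intro n
    rcases n.eq_zero_or_pos with rfl | hn
    · simp
    · have hn' : (0 : ℝ) < n := by exact_mod_cast hn
      rw [hpair.voronoiTransform_eq hα1 (div_pos hn' hx), cosTransform_comp_mul H hx]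
      push_cast
      field_simp
  have hlog := hpx.integrableOn_log hα1
  have hgi := hg.integrableOn hα1
  have hsplit : ∀ y : ℝ,
      f (x * y) * ((Real.log y + 2 * Real.eulerMascheroniConstant : ℝ) : ℂ) =
        (Real.log y : ℂ) * f (x * y) +
          (2 * Real.eulerMascheroniConstant : ℂ) * f (x * y) := by
    intro y; push_cast; ring
  have hdil : ∑' k : ℕ, ∑' m : ℕ, f (x * ((((k + 1) * (m + 1) : ℕ) : ℝ))) =
      ∑' k : ℕ, dilationSum (fun t => f (x * t)) (k + 1) := by
    refine tsum_congr fun k => tsum_congr fun m => ?_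
    push_cast
    rfl
  refine ⟨by simpa only [mul_comm x] using hs1, ?_, ?_, ?_⟩
  · simp only [hsplit]
    exact hlog.add (hgi.const_mul _)
  · simp only [hV]
    exact hs2.mul_left _
  · have hint : ∫ y in Ioi (0 : ℝ),
        f (x * y) * ((Real.log y + 2 * Real.eulerMascheroniConstant : ℝ) : ℂ) =
        ∫ t in Ioi (0 : ℝ), dilationSum (fun t => f (x * t)) t := by
      simp only [hsplit]
      rw [integral_add hlog (hgi.const_mul _), integral_const_mul, hpx.integral_eq_zero hα1,
        mul_zero, add_zero, hpx.integral_dilationSum hα1]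
    have hsum : ∑' n : ℕ, (n.divisors.card : ℂ) * f (n * x) =
        ∑' k : ℕ, dilationSum (fun t => f (x * t)) (k + 1) := by
      rw [← hdil, ← ht1]
      simp only [mul_comm x]
    rw [voronoiOperator, hint, hsum, hmain, mul_zero]
    simp only [hV]
    rw [tsum_mul_left, ht2, ← mul_assoc, ← Complex.ofReal_mul, inv_mul_cancel₀ hx.ne']
    push_cast
    rw [one_mul]
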